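/- \textbf{Theorem (Gaifman normal form for min-max semirings).} Let $\tau$ be a finite relational signature. Then every first-order $\tau$-sentence $\psi$ (in negation normal form) is minmax-equivalent to a local sentence. The notions are as follows. \emph{Semantics.} A \emph{min-max semiring} is a semiring $(K,\max,\min,0,1)$ given by a total order on $K$ with least element $0$ and greatest element $1\neq 0$. A \emph{$K$-interpretation} over a finite non-empty universe $A$ is a map $\pi$ from the instantiated literals $R\bar a$, $\neg R\bar a$ ($R\in\tau$, $\bar a$ a tuple over $A$) to $K$. It is \emph{model-defining} if for all $R,\bar a$ precisely one of $\pi(R\bar a)$, $\pi(\neg R\bar a)$ is $0$, and it \emph{tracks only positive information} if $\pi(\neg R\bar a)\in\{0,1\}$ for all $R,\bar a$. The Gaifman graph of $\pi$ has vertex set $A$, and $a\neq b$ are adjacent iff both occur in some tuple $\bar c$ with $\pi(R\bar c)\neq 0$ for some $R\in\tau$; $d(a,b)\in\mathbb N\cup\{\infty\}$ is the distance in this graph and $B_r(a)=\{b\in A: d(a,b)\le r\}$. Formulae in negation normal form are evaluated in $K$ by giving equalities and inequalities their truth values $0,1$, literals their value under $\pi$, and interpreting $\lor,\exists$ as sums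 ($\max$) and $\land,\forall$ as products ($\min$). \emph{Ball quantifiers} $\exists y\in B_r(x)$ and $\forall y\in B_r(x)$ ($r\in\mathbb N$) are interpreted as the sum and the product over the elements of $B_r(a)$, where $a$ is the value of $x$. Two sentences are \emph{minmax-equivalent} if they have the same value under every model-defining $K$-interpretation over a finite non-empty universe that tracks only positive information, for every min-max semiring $K$. \emph{Local sentences.} A formula $\varphi(x)$ is \emph{$r$-local around $x$} if it is built from $\tau$-literals (including equalities and inequalities) by $\land$, $\lor$ and ball quantifiers, and in the graph which has an edge from $z$ to $y$ of length $s$ for each quantifier $Qz\in B_s(y)$ in $\varphi$, every path ending in $x$ has total length at most $r$. A \emph{basic local sentence} is a sentence of the form \[ \exists y_1\cdots\exists y_m\Big(\bigwedge_{i<j} d(y_i,y_j)>2r\ \wedge\ \bigwedge_{i\le m}\varphi(y_i)\Big) \quad\text{or}\quad \forall y_1\cdots\forall y_m\Big(\bigvee_{i<j} d(y_i,y_j)\le 2r\ \vee\ \bigvee_{i\le m}\varphi(y_i)\Big) \] with $m\ge 1$, $r\in\mathbb N$ and $\varphi$ an $r$-local formula around one variable, where $d(x,y)\le s$ and $d(x,y)>s$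 abbreviate $\exists z\in B_s(x)\,(z=y)$ and $\forall z\in B_s(x)\,(z\neq y)$. A \emph{local sentence} is a positive Boolean combination (using $\land$, $\lor$) of basic local sentences. -/

import Mathlib

/-! # Semiring semantics of first-order logic with ball quantifiers, and local sentences

A relational signature is a Mathlib language `L` with `L.IsRelational`. -/

universe u v w x

namespace SemiringLogic

/-- Formulae in negation normal form over the signature `L`, with free variables among
`0, …, n - 1`, with ordinary quantifiers and with ball quantifiers.
A quantifier in a formula with `n` free variables binds the variable number `n` (`Fin.last n`) of
its body. `exBall r y φ` is `∃ z ∈ B_r(y). φ` and `allBall r y φ` is `∀ z ∈ B_r(y). φ`, where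
`z` is the newly bound variable. -/
inductive Formula (L : FirstOrder.Language.{u, v}) : ℕ → Type v
  | eq {n : ℕ} (i j : Fin n) : Formula L n
  | ne {n : ℕ} (i j : Fin n) : Formula L n
  | rel {n k : ℕ} (R : L.Relations k) (t : Fin k → Fin n) : Formula L n
  | nrel {n k : ℕ} (R : L.Relations k) (t : Fin k → Fin n) : Formula L n
  | and {n : ℕ} (φ ψ : Formula L n) : Formula L n
  | or {n : ℕ} (φ ψ : Formula L n) : Formula L n
  | ex {n : ℕ} (φ : Formula L (n + 1)) : Formula L n
  | all {n : ℕ} (φ : Formula L (n + 1)) : Formula L n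
  | exBall {n : ℕ} (r : ℕ) (y : Fin n) (φ : Formula L (n + 1)) : Formula L n
  | allBall {n : ℕ} (r : ℕ) (y : Fin n) (φ : Formula L (n + 1)) : Formula L n

/-- The instantiated literals `R a` and `¬ R a` over the universe `A`. -/
inductive Literal (L : FirstOrder.Language.{u, v}) (A : Type w) : Type (max v w)
  | pos {k : ℕ} (R : L.Relations k) (a : Fin k → A) : Literal L A
  | neg {k : ℕ} (R : L.Relations k) (a : Fin k → A) : Literal L A

/-- A `K`-interpretation of signature `L` over the universe `A`. -/
abbrev Interpretation (L : FirstOrder.Language.{u, v}) (A : Type w) (K : Type x) :=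
  Literal L A → K

section Interpretations

variable {L : FirstOrder.Language.{u, v}} {A : Type w} {K : Type x}

/-- For each pair of complementary literals, precisely one of the two values is `0`. -/
def ModelDefining [Zero K] (π : Interpretation L A K) : Prop :=
  ∀ (k : ℕ) (R : L.Relations k) (a : Fin k → A),
    Xor (π (.pos R a) = 0) (π (.neg R a) = 0)

/-- Negative literals only take the values `0` and `1`. -/
def TracksOnlyPositive [Zero K] [One K] (π : Interpretation L A K) : Prop :=
  ∀ (k : ℕ) (R : L.Relations k) (a : Fin k → A), π (.neg R a) = 0 ∨ π (.neg R a) = 1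

/-- The Boolean structure induced by an interpretation (the one that a model-defining
interpretation defines). -/
@[reducible] def inducedStructure [L.IsRelational] [Zero K] (π : Interpretation L A K) :
    L.Structure A where
  funMap := fun f => isEmptyElim f
  RelMap := fun R a => π (.pos R a) ≠ 0

/-- The Gaifman graph of a structure: two distinct elements are adjacent if they occur together
in some tuple of some relation. -/
def gaifmanGraph (S : L.Structure A) : SimpleGraph A where
  Adj a b := a ≠ b ∧ ∃ (k : ℕ) (R : L.Relations k) (c : Fin k → A),
    S.RelMap R c ∧ a ∈ Set.range c ∧ b ∈ Set.range c
  symm := ⟨fun _ _ ⟨hne, k, R, c, hR, ha, hb⟩ => ⟨hne.symm, k, R, c, hR, hb, ha⟩⟩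
  loopless := ⟨fun _ h => h.1 rfl⟩

open Classical in
/-- The `r`-neighbourhood of `a` in the Gaifman graph of the structure induced by `π`. Distances
are extended natural numbers (infinite between different components). -/
noncomputable def ball [L.IsRelational] [Zero K] [Fintype A] (π : Interpretation L A K)
    (r : ℕ) (a : A) : Finset A :=
  Finset.univ.filter fun b => (gaifmanGraph (inducedStructure π)).edist a b ≤ (r : ℕ∞)

open Classical in
/-- The semiring semantics `π⟦φ(a)⟧`. -/
noncomputable def Formula.eval [L.IsRelational] [CommSemiring K] [Fintype A]
    (π : Interpretation L A K) : {n : ℕ} → Formula L n → (Fin n → A) → K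
  | _, .eq i j, a => if a i = a j then 1 else 0
  | _, .ne i j, a => if a i ≠ a j then 1 else 0
  | _, .rel R t, a => π (.pos R fun i => a (t i))
  | _, .nrel R t, a => π (.neg R fun i => a (t i))
  | _, .and φ ψ, a => φ.eval π a * ψ.eval π a
  | _, .or φ ψ, a => φ.eval π a + ψ.eval π a
  | _, .ex φ, a => ∑ b : A, φ.eval π (Fin.snoc (α := fun _ => A) a b)
  | _, .all φ, a => ∏ b : A, φ.eval π (Fin.snoc (α := fun _ => A) a b)
  | _, .exBall r y φ, a => ∑ b ∈ ball π r (a y), φ.eval π (Fin.snoc (α := fun _ => A) a b)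
  | _, .allBall r y φ, a => ∏ b ∈ ball π r (a y), φ.eval π (Fin.snoc (α := fun _ => A) a b)

end Interpretations

namespace Formula

variable {L : FirstOrder.Language.{u, v}}

/-- First-order formulae: no ball quantifiers occur. -/
def IsFirstOrder : {n : ℕ} → Formula L n → Prop
  | _, .eq _ _ => True
  | _, .ne _ _ => True
  | _, .rel _ _ => True
  | _, .nrel _ _ => True
  | _, .and φ ψ => φ.IsFirstOrder ∧ ψ.IsFirstOrder
  | _, .or φ ψ => φ.IsFirstOrder ∧ ψ.IsFirstOrder
  | _, .ex φ => φ.IsFirstOrder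
  | _, .all φ => φ.IsFirstOrder
  | _, .exBall _ _ _ => False
  | _, .allBall _ _ _ => False

/-- Auxiliary predicate for `IsLocal`. In the quantification dag, a variable bound by a ball
quantifier around `y` with radius `s` has exactly one outgoing edge, to `y`, with label `s`. So the
path from a variable to a free variable is unique; `d` records the total length of this path
for the variables in scope. Only literals, `∧`, `∨` and ball quantifiers may occur, and all
these path lengths must be at most `r`. -/
def IsLocalAux (r : ℕ) : {n : ℕ} → (Fin n → ℕ) → Formula L n → Prop
  | _, _, .eq _ _ => True
  | _, _, .ne _ _ => True
  | _, _, .rel _ _ => True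
  | _, _, .nrel _ _ => True
  | _, d, .and φ ψ => φ.IsLocalAux r d ∧ ψ.IsLocalAux r d
  | _, d, .or φ ψ => φ.IsLocalAux r d ∧ ψ.IsLocalAux r d
  | _, _, .ex _ => False
  | _, _, .all _ => False
  | _, d, .exBall s y φ =>
      d y + s ≤ r ∧ φ.IsLocalAux r (Fin.snoc (α := fun _ => ℕ) d (d y + s))
  | _, d, .allBall s y φ =>
      d y + s ≤ r ∧ φ.IsLocalAux r (Fin.snoc (α := fun _ => ℕ) d (d y + s))

/-- `r`-local formulae around their free variables. -/
def IsLocal (r : ℕ) {n : ℕ} (φ : Formula L n) : Prop :=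
  φ.IsLocalAux r (fun _ => 0)

/-- Extend a renaming of the free variables to the scope of a quantifier. -/
def liftRenaming {n m : ℕ} (f : Fin n → Fin m) : Fin (n + 1) → Fin (m + 1) :=
  Fin.snoc (α := fun _ => Fin (m + 1)) (fun i => (f i).castSucc) (Fin.last m)

/-- Rename the free variables of a formula (bound variables are never captured). -/
def rename : {n m : ℕ} → (Fin n → Fin m) → Formula L n → Formula L m
  | _, _, f, .eq i j => .eq (f i) (f j)
  | _, _, f, .ne i j => .ne (f i) (f j)
  | _, _, f, .rel R t => .rel R fun i => f (t i)
  | _, _, f, .nrel R t => .nrel R fun i => f (t i)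
  | _, _, f, .and φ ψ => .and (φ.rename f) (ψ.rename f)
  | _, _, f, .or φ ψ => .or (φ.rename f) (ψ.rename f)
  | _, _, f, .ex φ => .ex (φ.rename (liftRenaming f))
  | _, _, f, .all φ => .all (φ.rename (liftRenaming f))
  | _, _, f, .exBall r y φ => .exBall r (f y) (φ.rename (liftRenaming f))
  | _, _, f, .allBall r y φ => .allBall r (f y) (φ.rename (liftRenaming f))

/-- `φ(y_i)` for a formula `φ` with one free variable. -/
def at' {m : ℕ} (φ : Formula L 1) (i : Fin m) : Formula L m :=
  φ.rename fun _ => i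

/-- `d(y_i, y_j) ≤ s`, that is `∃ z ∈ B_s(y_i). z = y_j`. -/
def distLE {n : ℕ} (s : ℕ) (i j : Fin n) : Formula L n :=
  .exBall s i (.eq (Fin.last n) j.castSucc)

/-- `d(y_i, y_j) > s`, that is `∀ z ∈ B_s(y_i). z ≠ y_j`. -/
def distGT {n : ℕ} (s : ℕ) (i j : Fin n) : Formula L n :=
  .allBall s i (.ne (Fin.last n) j.castSucc)

/-- `∃ y_1 … ∃ y_n. φ`. -/
def exs : {n : ℕ} → Formula L n → Formula L 0
  | 0, φ => φ
  | _ + 1, φ => exs (.ex φ)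

/-- `∀ y_1 … ∀ y_n. φ`. -/
def alls : {n : ℕ} → Formula L n → Formula L 0
  | 0, φ => φ
  | _ + 1, φ => alls (.all φ)

/-- The list of all pairs `(i, j)` of indices with `i < j`. -/
def indexPairs (m : ℕ) : List (Fin m × Fin m) :=
  (List.finRange m ×ˢ List.finRange m).filter fun p => p.1 < p.2

/-- The scattered quantifier
`∃ y_1 … ∃ y_m. ⋀_{i<j} d(y_i, y_j) > 2 r ∧ θ(y_1, …, y_m)`. -/
def exScattered (r : ℕ) {m : ℕ} (θ : Formula L m) : Formula L 0 :=
  exs (((indexPairs m).map fun p => distGT (2 * r) p.1 p.2).foldr .and θ)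

/-- The scattered quantifier
`∀ y_1 … ∀ y_m. ⋁_{i<j} d(y_i, y_j) ≤ 2 r ∨ θ(y_1, …, y_m)`. -/
def allScattered (r : ℕ) {m : ℕ} (θ : Formula L m) : Formula L 0 :=
  alls (((indexPairs m).map fun p => distLE (2 * r) p.1 p.2).foldr .or θ)

/-- `φ(y_1) ∧ … ∧ φ(y_m)` with `m = k + 1`. -/
def conjAt (k : ℕ) (φ : Formula L 1) : Formula L (k + 1) :=
  ((List.finRange k).map fun i => φ.at' i.castSucc).foldr .and (φ.at' (Fin.last k))

/-- `φ(y_1) ∨ … ∨ φ(y_m)` with `m = k + 1`. -/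
def disjAt (k : ℕ) (φ : Formula L 1) : Formula L (k + 1) :=
  ((List.finRange k).map fun i => φ.at' i.castSucc).foldr .or (φ.at' (Fin.last k))

/-- Local sentences: positive Boolean combinations of basic local sentences, which are
scattered existential quantifications of `⋀_i φ(y_i)` and scattered universal quantifications
of `⋁_i φ(y_i)`, with `m = k + 1 ≥ 1` variables and one and the same `r`-local formula `φ`. -/
inductive IsLocalSentence : Formula L 0 → Prop
  | basicEx (r k : ℕ) (φ : Formula L 1) (hφ : φ.IsLocal r) :
      IsLocalSentence (exScattered r (conjAt k φ))
  | basicAll (r k : ℕ) (φ : Formula L 1) (hφ : φ.IsLocal r) :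
      IsLocalSentence (allScattered r (disjAt k φ))
  | and {φ ψ : Formula L 0} (hφ : IsLocalSentence φ) (hψ : IsLocalSentence ψ) :
      IsLocalSentence (.and φ ψ)
  | or {φ ψ : Formula L 0} (hφ : IsLocalSentence φ) (hψ : IsLocalSentence ψ) :
      IsLocalSentence (.or φ ψ)

end Formula

/-- `K` is the semiring `(K, max, min, 0, 1)` of a linear order with `0 ≠ 1`. That `0` is the least
and `1` the greatest element follows, as these are the neutral elements of `max` and `min`. -/
class IsMinMaxSemiring (K : Type x) [CommSemiring K] [LinearOrder K] : Prop where
  zero_ne_one : (0 : K) ≠ 1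
  add_eq_max : ∀ a b : K, a + b = max a b
  mul_eq_min : ∀ a b : K, a * b = min a b

/-- `K`-equivalence: equal values under all model-defining `K`-interpretations over finite
(non-empty) universes that track only positive information. -/
def KEquiv {L : FirstOrder.Language.{u, v}} [L.IsRelational] (K : Type x) [CommSemiring K]
    {n : ℕ} (φ ψ : Formula L n) : Prop :=
  ∀ (A : Type w) [Fintype A] [Nonempty A] (π : Interpretation L A K),
    ModelDefining π → TracksOnlyPositive π →
      ∀ a : Fin n → A, φ.eval π a = ψ.eval π a

/-- Minmax-equivalence: `K`-equivalence for all min-max semirings `K`. -/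
def MinMaxEquiv {L : FirstOrder.Language.{u, v}} [L.IsRelational] {n : ℕ}
    (φ ψ : Formula L n) : Prop :=
  ∀ (K : Type x) [CommSemiring K] [LinearOrder K] [IsMinMaxSemiring K],
    KEquiv.{u, v, w, x} K φ ψ

end SemiringLogic

/-! For a threshold `c > 0` in a min-max semiring, the condition that a value is at least `c`
commutes with all connectives and quantifiers. So each threshold turns an interpretation into a
Boolean model in which `R a` and `¬ R a` are separate atoms, and agreement in all such models gives
minmax-equivalence (`minMaxEquiv_of_sat_iff`). What survives of the assumptions on the
interpretation is locality: true positive atoms have near entries, and negative atoms with distant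
entries are true.

Without negation, models can only be compared in one direction. It suffices that preservation of
finitely many local sentences from `M` to `M'` implies preservation of `ψ`
(`exists_isLocalSentence_of_preserved`). This follows from a winning strategy in an
Ehrenfeucht–Fraïssé game whose positions carry true atoms from `M` to `M'`, but not back.

Existential local sentences carry a scattered set of `M` to one of `M'` with larger local types;
universal ones, read contrapositively, carry scattered sets of `M'` back. As types are only compared
by inclusion, counting realizations is not enough. Hall's theorem turns the images into injective
choices, and an argument of Mendelsohn–Dulmage type merges the choices in both directions into one
matching (`exists_matching`). Both need candidates to form well separated clusters; a pigeonhole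
argument finds a range of radii on which the relevant separation numbers are constant.

Finally, a local type is either rare, hence covered by few balls, or frequent, with many scattered
realizations; `exists_gap` makes the contrast large. The matching yields a local position containing
the centres of all rare types of both sides. Moves near the position are answered locally; any other
move has a frequent type and is answered far from the position (`BackForth.globalBackForth`). -/

namespace SemiringLogic

/-- A family of symmetric nearness relations `near r`, satisfying the triangle inequality. -/
structure Nearness (A : Type*) where
  near : ℕ → A → A → Prop
  refl : ∀ r a, near r a a
  symm : ∀ {r a b}, near r a b → near r b a
  mono : ∀ {r s a b}, r ≤ s → near r a b → near s a b
  trans : ∀ {r s a b c}, near r a b → near s b c → near (r + s) a c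

/-! ### Separated sets and separation numbers -/

namespace Nearness

variable {A : Type*} (d : Nearness A)

/-- Distinct elements of `S` are not `c`-near. -/
def Separated (c : ℕ) (S : Finset A) : Prop :=
  ∀ a ∈ S, ∀ b ∈ S, d.near c a b → a = b

variable {d}

theorem Separated.subset {c : ℕ} {S T : Finset A} (h : d.Separated c T) (hST : S ⊆ T) :
    d.Separated c S :=
  fun a ha b hb => h a (hST ha) b (hST hb)

theorem Separated.anti {c c' : ℕ} {S : Finset A} (h : d.Separated c' S) (hc : c ≤ c') :
    d.Separated c S :=
  fun a ha b hb hab => h a ha b hb (d.mono hc hab)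

theorem near_of_near_near {r s t : ℕ} {a b c : A} (h₁ : d.near r a c) (h₂ : d.near s b c)
    (h : r + s ≤ t) : d.near t a b :=
  d.mono h (d.trans h₁ (d.symm h₂))

/-- A point of `F` is `c`-near at most one element of `S`, as two such elements would be `2 *
c`-near each other. -/
theorem Separated.exists_far {c : ℕ} {S F : Finset A} (hS : d.Separated (2 * c) S)
    (hF : F.card < S.card) : ∃ e ∈ S, ∀ y ∈ F, ¬ d.near c e y := by
  by_contra! h
  choose! f hfF hf using h
  refine hF.not_ge (Finset.card_le_card_of_injOn f hfF fun a ha b hb hab => ?_)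
  exact hS a ha b hb (near_of_near_near (hf a ha) (hab ▸ hf b hb) (by omega))

variable (d)

/-- The maximal size of a `c`-separated subset of `U`. -/
noncomputable def sepNum (c : ℕ) (U : Set A) : ℕ :=
  sSup {k | ∃ S : Finset A, ↑S ⊆ U ∧ d.Separated c S ∧ S.card = k}

variable {d} [Finite A]

theorem bddAbove_sepCards (c : ℕ) (U : Set A) :
    BddAbove {k | ∃ S : Finset A, ↑S ⊆ U ∧ d.Separated c S ∧ S.card = k} := by
  have := Fintype.ofFinite A
  refine ⟨Fintype.card A, ?_⟩
  rintro _ ⟨S, -, -, rfl⟩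
  exact S.card_le_univ

theorem card_le_sepNum {c : ℕ} {U : Set A} {S : Finset A} (hS : ↑S ⊆ U)
    (hsep : d.Separated c S) : S.card ≤ d.sepNum c U :=
  le_csSup (bddAbove_sepCards c U) ⟨S, hS, hsep, rfl⟩

variable (d) in
theorem exists_card_eq_sepNum (c : ℕ) (U : Set A) :
    ∃ S : Finset A, ↑S ⊆ U ∧ d.Separated c S ∧ S.card = d.sepNum c U :=
  Nat.sSup_mem (s := {k | ∃ S : Finset A, (S : Set A) ⊆ U ∧ d.Separated c S ∧ S.card = k})
    ⟨0, ∅, by simp, by simp [Separated], rfl⟩ (bddAbove_sepCards c U)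

theorem exists_card_eq {c k : ℕ} {U : Set A} (hk : k ≤ d.sepNum c U) :
    ∃ S : Finset A, ↑S ⊆ U ∧ d.Separated c S ∧ S.card = k := by
  obtain ⟨S, hSU, hS, hcard⟩ := d.exists_card_eq_sepNum c U
  obtain ⟨T, hTS, hT⟩ := Finset.exists_subset_card_eq (hcard ▸ hk)
  exact ⟨T, (Finset.coe_subset.2 hTS).trans hSU, hS.subset hTS, hT⟩

/-- A separated set of maximal size is a net: a point far from it could be added. -/
theorem exists_near_of_sepNum_le {c : ℕ} {U : Set A} {S : Finset A} (hS : ↑S ⊆ U)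
    (hsep : d.Separated c S) (hcard : d.sepNum c U ≤ S.card) {x : A} (hx : x ∈ U) :
    ∃ y ∈ S, d.near c x y := by
  classical
  by_contra! h
  have hxS : x ∉ S := fun hxS => h x hxS (d.refl c x)
  have : (insert x S).card ≤ d.sepNum c U := by
    refine card_le_sepNum (by simpa [Set.insert_subset_iff] using ⟨hx, hS⟩) ?_
    intro a ha b hb hab
    rcases Finset.mem_insert.1 ha with ha | ha <;> rcases Finset.mem_insert.1 hb with hb | hb
    · rw [ha, hb]
    · exact absurd (ha ▸ hab) (h b hb)
    · exact absurd (d.symm (hb ▸ hab)) (h a ha)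
    · exact hsep a ha b hb hab
  rw [Finset.card_insert_of_notMem hxS] at this
  omega

theorem sepNum_anti {c c' : ℕ} {U U' : Set A} (hc : c ≤ c') (hU : U' ⊆ U) :
    d.sepNum c' U' ≤ d.sepNum c U := by
  obtain ⟨S, hSU, hS, hcard⟩ := d.exists_card_eq_sepNum c' U'
  exact hcard ▸ card_le_sepNum (hSU.trans hU) (hS.anti hc)

theorem sepNum_union_le (c : ℕ) (U V : Set A) :
    d.sepNum c (U ∪ V) ≤ d.sepNum c U + d.sepNum c V := by
  classical
  obtain ⟨S, hSU, hS, hcard⟩ := d.exists_card_eq_sepNum c (U ∪ V)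
  have h₁ : (S.filter (· ∈ U)).card ≤ d.sepNum c U :=
    card_le_sepNum (fun a ha => (Finset.mem_filter.1 ha).2) (hS.subset (Finset.filter_subset _ _))
  have h₂ : (S.filter (· ∉ U)).card ≤ d.sepNum c V :=
    card_le_sepNum (fun a ha => (hSU (Finset.mem_filter.1 ha).1).resolve_left
      (Finset.mem_filter.1 ha).2) (hS.subset (Finset.filter_subset _ _))
  have := S.card_filter_add_card_filter_not (· ∈ U)
  omega

theorem sepNum_coe_le (c : ℕ) (X : Finset A) : d.sepNum c (X : Set A) ≤ X.card := by
  obtain ⟨S, hSU, -, hcard⟩ := d.exists_card_eq_sepNum c (X : Set A)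
  exact hcard ▸ Finset.card_le_card (Finset.coe_subset.1 hSU)

end Nearness

/-! ### Separated choices of representatives -/

open Nearness

/-- The radius of local moves at rank `m`. -/
def moveRadius (m : ℕ) : ℕ := 2 * 4 ^ m

theorem moveRadius_mono : Monotone moveRadius := fun _ _ h =>
  Nat.mul_le_mul_left 2 (Nat.pow_le_pow_right (by norm_num) h)

/-- `S` has an image of the same size under the relation `R` that is separated at the radius
`moveRadius m`. -/
def HasSepImage {α β : Type*} (dβ : Nearness β) (R : α → β → Prop) (m : ℕ) (S : Finset α) : Prop :=
  ∃ S' : Finset β, dβ.Separated (moveRadius m) S' ∧ S'.card = S.card ∧ ∀ e ∈ S', ∃ x ∈ S, R x e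

/-- The elements of `X'` together with the image of `I` under `R`. -/
def withImage {α β : Type*} (R : α → β → Prop) (X' : Finset β) (I : Finset α) : Set β :=
  ↑X' ∪ {e | ∃ x ∈ I, R x e}

theorem withImage_mono {α β : Type*} {R R' : α → β → Prop} {X' : Finset β} {I : Finset α}
    (h : ∀ x y, R x y → R' x y) : withImage R X' I ⊆ withImage R' X' I :=
  Set.union_subset_union_right _ fun _ ⟨x, hx, hxe⟩ => ⟨x, hx, h _ _ hxe⟩

theorem sepNum_withImage_le {α β : Type*} [Finite β] (dβ : Nearness β) (R : α → β → Prop)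
    (X' : Finset β) (I : Finset α) (c b : ℕ)
    (h : ∀ x ∈ I, dβ.sepNum c (withImage R X' {x}) ≤ b) :
    dβ.sepNum c (withImage R X' I) ≤ X'.card + I.card * b := by
  classical
  induction I using Finset.induction_on with
  | empty => simpa [withImage] using sepNum_coe_le c X'
  | insert a I ha ih =>
    have h₁ := ih fun x hx => h x (Finset.mem_insert_of_mem hx)
    have h₂ := h a (Finset.mem_insert_self a I)
    have h₃ : withImage R X' (insert a I) ⊆ withImage R X' I ∪ withImage R X' {a} := by
      rintro e (he | ⟨x, hx, hxe⟩)
      · exact .inl (.inl he)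
      · rcases Finset.mem_insert.1 hx with rfl | hx
        · exact .inr (.inr ⟨x, by simp, hxe⟩)
        · exact .inl (.inr ⟨x, hx, hxe⟩)
    have h₄ := (sepNum_anti (d := dβ) le_rfl h₃).trans (sepNum_union_le c _ _)
    rw [Finset.card_insert_of_notMem ha, Nat.add_mul]
    omega

/-- A choice of related elements for all `x ∈ I` that are not `c`-near each other, each of which
is either `r`-near or not `c`-near to any given element of `X'`. -/
structure IsSeparatedChoice {α β : Type*} (dβ : Nearness β) (R : α → β → Prop) (X' : Finset β)
    (r c : ℕ) (I : Finset α) (e : α → β) : Prop where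
  rel : ∀ x ∈ I, R x (e x)
  sep : ∀ x ∈ I, ∀ y ∈ I, dβ.near c (e x) (e y) → x = y
  near_or_far : ∀ x ∈ I, ∀ x' ∈ X', dβ.near c (e x) x' → dβ.near r (e x) x'

/-- Hall's theorem for separated sets, for elements with few candidates. -/
theorem exists_isSeparatedChoice_of_covered {α β : Type*} [Finite β] [Nonempty β] (dβ : Nearness β)
    (R R₀ : α → β → Prop) (hR : ∀ x y, R x y → R₀ x y) (X' : Finset β) (I : Finset α)
    (u c m : ℕ) (hu : c + 2 * u ≤ moveRadius m)
    (himg : ∀ J ⊆ I, HasSepImage dβ R m J)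
    (hclean : dβ.sepNum u (withImage R₀ X' I) ≤ dβ.sepNum (moveRadius m) (withImage R X' I)) :
    ∃ e : α → β, IsSeparatedChoice dβ R X' (2 * u) c I e := by
  classical
  obtain ⟨Z, hZU, hZ, hZcard⟩ := dβ.exists_card_eq_sepNum (moveRadius m) (withImage R X' I)
  -- `Z` is separated at the large radius, yet by `hclean` of maximal size already at the small
  -- radius `u`. So its elements are centres of clusters that contain all candidates and all of
  -- `X'`.
  have hcover : ∀ e ∈ withImage R X' I, ∃ z ∈ Z, dβ.near u e z := fun e he =>
    exists_near_of_sepNum_le (hZU.trans (withImage_mono hR)) (hZ.anti (by omega))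
      (hclean.trans hZcard.ge) (withImage_mono hR he)
  -- Hall's theorem is applied to clusters rather than candidates. Its condition holds because two
  -- elements of a separated image never lie in the same cluster.
  let t : I → Finset β := fun x => Z.filter fun z => ∃ e, R x e ∧ dβ.near u e z
  have hall : ∀ s : Finset I, s.card ≤ (s.biUnion t).card := by
    intro s
    obtain ⟨S', hS', hcard, hSR⟩ := himg (s.map (Function.Embedding.subtype _)) (by
      intro x hx
      obtain ⟨y, -, rfl⟩ := Finset.mem_map.1 hx
      exact y.2)
    rw [Finset.card_map] at hcard
    rw [← hcard]
    have h : ∀ e ∈ S', ∃ z ∈ s.biUnion t, dβ.near u e z := by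
      intro e he
      obtain ⟨x, hx, hxe⟩ := hSR e he
      obtain ⟨y, hy, rfl⟩ := Finset.mem_map.1 hx
      obtain ⟨z, hz, hez⟩ := hcover e (.inr ⟨_, y.2, hxe⟩)
      exact ⟨z, Finset.mem_biUnion.2 ⟨y, hy, Finset.mem_filter.2 ⟨hz, e, hxe, hez⟩⟩, hez⟩
    choose! f hf hfn using h
    refine Finset.card_le_card_of_injOn f hf fun a ha b hb hab => ?_
    exact hS' a ha b hb (near_of_near_near (hfn a ha) (hab ▸ hfn b hb) (by omega))
  obtain ⟨h, hinj, ht⟩ := (Finset.all_card_le_biUnion_card_iff_exists_injective t).1 hall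
  have ht' : ∀ x (hx : x ∈ I), ∃ e, R x e ∧ dβ.near u e (h ⟨x, hx⟩) := fun x hx =>
    (Finset.mem_filter.1 (ht ⟨x, hx⟩)).2
  have hZh : ∀ x, h x ∈ Z := fun x => (Finset.mem_filter.1 (ht x)).1
  choose! e he hen using ht'
  refine ⟨e, he, fun x hx y hy hxy => ?_, fun x hx x' hx' hxx' => ?_⟩
  · have h₁ := hZ _ (hZh ⟨x, hx⟩) _ (hZh ⟨y, hy⟩) (dβ.mono (by omega)
      (dβ.trans (dβ.symm (hen x hx)) (dβ.trans hxy (hen y hy))))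
    exact congrArg Subtype.val (hinj h₁)
  -- A choice `c`-near `x'` lies in the same cluster as `x'`, hence within `2 * u`.
  · obtain ⟨z, hz, hxz⟩ := hcover x' (.inl hx')
    have h₁ := hZ _ (hZh ⟨x, hx⟩) _ hz (dβ.mono (by omega)
      (dβ.trans (dβ.symm (hen x hx)) (dβ.trans hxx' hxz)))
    exact near_of_near_near (hen x hx) (h₁ ▸ hxz) (by omega)

/-- Elements with many candidates can be added greedily to a separated choice. -/
theorem IsSeparatedChoice.exists_union {α β : Type*} [DecidableEq α] [Finite β]
    {dβ : Nearness β} {R : α → β → Prop} {X' : Finset β} {r c : ℕ} {I : Finset α} {e : α → β}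
    (he : IsSeparatedChoice dβ R X' r c I e) {m b : ℕ} (hc : 2 * c ≤ moveRadius m)
    (J : Finset α) (hb : 2 * X'.card + (I.card + J.card) ≤ b)
    (hJ : ∀ x ∈ J, b < dβ.sepNum (moveRadius m) (withImage R X' {x})) :
    ∃ e : α → β, IsSeparatedChoice dβ R X' r c (I ∪ J) e := by
  classical
  induction J using Finset.induction_on with
  | empty => exact ⟨e, by simpa using he⟩
  | insert a J ha ih =>
    rw [Finset.card_insert_of_notMem ha] at hb
    obtain ⟨e', he'⟩ := ih (by omega) fun x hx => hJ x (Finset.mem_insert_of_mem hx)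
    by_cases haI : a ∈ I ∪ J
    · exact ⟨e', by rwa [Finset.union_insert, Finset.insert_eq_of_mem haI]⟩
    obtain ⟨S, hSU, hS, hScard⟩ :=
      dβ.exists_card_eq_sepNum (moveRadius m) (withImage R X' {a})
    have h₁ := hJ a (Finset.mem_insert_self a J)
    -- Members of `X'` in `S` need not be candidates for `a` and are discarded; this is why `X'`
    -- counts twice in `b`, the other time as a set to be avoided.
    have h₂ : (S \ X').card ≥ S.card - X'.card := Finset.le_card_sdiff X' S
    have h₃ := Finset.card_union_le X' ((I ∪ J).image e')
    have h₄ := (Finset.card_image_le (s := I ∪ J) (f := e')).trans (Finset.card_union_le I J)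
    obtain ⟨y, hy, hyf⟩ := ((hS.subset (Finset.sdiff_subset (t := X'))).anti hc).exists_far
      (F := X' ∪ (I ∪ J).image e') (by omega)
    have hyS := Finset.mem_sdiff.1 hy
    have hRy : R a y := by
      rcases hSU hyS.1 with h | ⟨x, hx, hxy⟩
      · exact absurd h hyS.2
      · rwa [Finset.mem_singleton.1 hx] at hxy
    have hne : ∀ x ∈ I ∪ J, x ≠ a := fun x hx h => haI (h ▸ hx)
    have hfar : ∀ x ∈ I ∪ J, ¬ dβ.near c y (e' x) := fun x hx =>
      hyf _ (Finset.mem_union_right _ (Finset.mem_image_of_mem _ hx))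
    have hupd : ∀ x ∈ I ∪ J, Function.update e' a y x = e' x := fun x hx =>
      Function.update_of_ne (hne x hx) _ _
    refine ⟨Function.update e' a y, ?_⟩
    rw [Finset.union_insert]
    refine ⟨fun x hx => ?_, fun x hx z hz hxz => ?_, fun x hx x' hx' hxx' => ?_⟩
    · rcases Finset.mem_insert.1 hx with rfl | hx
      · rwa [Function.update_self]
      · rw [hupd x hx]
        exact he'.rel x hx
    · rcases Finset.mem_insert.1 hx with rfl | hx <;> rcases Finset.mem_insert.1 hz with h | hz
      · exact h.symm
      · rw [Function.update_self, hupd z hz] at hxz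
        exact absurd hxz (hfar z hz)
      · rw [h, Function.update_self, hupd x hx] at hxz
        exact absurd (dβ.symm hxz) (hfar x hx)
      · rw [hupd x hx, hupd z hz] at hxz
        exact he'.sep x hx z hz hxz
    · rcases Finset.mem_insert.1 hx with rfl | hx
      · rw [Function.update_self] at hxx'
        exact absurd hxx' (hyf _ (Finset.mem_union_left _ hx'))
      · rw [hupd x hx] at hxx' ⊢
        exact he'.near_or_far x hx x' hx' hxx'

/-- The bound at which separation numbers are capped. -/
def sepCap (K : ℕ) : ℕ := K + K * (4 * K) + 4 * K + 1

/-- Elements with at most `4 * K` separated candidates are served by Hall's theorem, the others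
greedily afterwards. For the former, separation numbers are at most `K + K * (4 * K)`, below `sepCap
K`, so the capped equality is a true one; for the latter, exceeding `4 * K` is still visible under
the cap. The value `4 * K` is the greedy bound, from `2 * K` for `X'` and `K` for each of the two
groups. -/
theorem exists_isSeparatedChoice {α β : Type*} [Finite β] [Nonempty β] (dβ : Nearness β)
    (R R₀ : α → β → Prop) (hR : ∀ x y, R x y → R₀ x y) (X' : Finset β) (I : Finset α)
    (K u c m : ℕ) (hX' : X'.card ≤ K) (hI : I.card ≤ K)
    (hu : c + 2 * u ≤ moveRadius m) (hc : 2 * c ≤ moveRadius m)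
    (himg : ∀ J ⊆ I, HasSepImage dβ R m J)
    (hclean : ∀ J ⊆ I, min (sepCap K) (dβ.sepNum u (withImage R₀ X' J)) =
      min (sepCap K) (dβ.sepNum (moveRadius m) (withImage R X' J))) :
    ∃ e : α → β, IsSeparatedChoice dβ R X' (2 * u) c I e := by
  classical
  let Sm := I.filter fun x => dβ.sepNum u (withImage R₀ X' {x}) ≤ 4 * K
  let Bg := I.filter fun x => ¬ dβ.sepNum u (withImage R₀ X' {x}) ≤ 4 * K
  have hSm : Sm ⊆ I := Finset.filter_subset _ _
  have hBg : Bg ⊆ I := Finset.filter_subset _ _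
  have hcS := Finset.card_le_card hSm
  have hcB := Finset.card_le_card hBg
  have h₁ := sepNum_withImage_le dβ R₀ X' Sm u (4 * K) fun x hx => (Finset.mem_filter.1 hx).2
  have h₂ := hclean Sm hSm
  have h₃ : Sm.card * (4 * K) ≤ K * (4 * K) := Nat.mul_le_mul_right _ (hcS.trans hI)
  obtain ⟨e, he⟩ := exists_isSeparatedChoice_of_covered dβ R R₀ hR X' Sm u c m hu
    (fun J hJ => himg J (hJ.trans hSm)) (by rw [sepCap] at h₂; omega)
  have h₄ := he.exists_union hc Bg (b := 4 * K) (by omega) fun x hx => by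
    have h₅ := hclean {x} (by simpa using hBg hx)
    have h₆ := (Finset.mem_filter.1 hx).2
    rw [sepCap] at h₅
    omega
  rwa [Finset.filter_union_filter_not_eq] at h₄

/-! ### Merging choices in opposite directions -/

/-- The elements of `Y'` whose partner has to be chosen by `g` if the matching, which uses
`e` for elements of `Y` where possible, is to cover `Y'`. -/
inductive Reached {α β : Type*} (dα : Nearness α) (dβ : Nearness β) (r : ℕ) (Y : Finset α)
    (Y' : Finset β) (e : α → β) (g : β → α) : β → Prop
  | base {b : β} (hb : b ∈ Y') (h : ∀ a ∈ Y, ¬ dβ.near r (e a) b) : Reached dα dβ r Y Y' e g b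
  | step {b b' : β} {a : α} (h : Reached dα dβ r Y Y' e g b) (ha : a ∈ Y) (hb' : b' ∈ Y')
      (h₁ : dα.near r (g b) a) (h₂ : dβ.near r (e a) b') : Reached dα dβ r Y Y' e g b'

theorem Reached.mem {α β : Type*} {dα : Nearness α} {dβ : Nearness β} {r : ℕ} {Y : Finset α}
    {Y' : Finset β} {e : α → β} {g : β → α} {b : β} (h : Reached dα dβ r Y Y' e g b) :
    b ∈ Y' := by
  cases h <;> assumption

/-- Two separated choices in opposite directions merge to a matching (as in the theorem of
Mendelsohn and Dulmage). -/
theorem exists_matching_of_choices {α β : Type*} (dα : Nearness α) (dβ : Nearness β)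
    (R : α → β → Prop) (Y : Finset α) (Y' : Finset β) (r c : ℕ) (hrc : 2 * r ≤ c)
    (hY : dα.Separated c Y) (hY' : dβ.Separated c Y') (e : α → β) (g : β → α)
    (he : IsSeparatedChoice dβ R Y' r c Y e)
    (hg : IsSeparatedChoice dα (fun y x => R x y) Y r c Y' g) :
    ∃ P : Finset (α × β), P.card ≤ Y.card + Y'.card ∧ (∀ p ∈ P, R p.1 p.2) ∧
      (∀ p ∈ P, ∀ q ∈ P, dα.near c p.1 q.1 ∨ dβ.near c p.2 q.2 → p = q) ∧
      (∀ x ∈ Y, ∃ p ∈ P, dα.near r x p.1) ∧ ∀ y ∈ Y', ∃ p ∈ P, dβ.near r y p.2 := by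
  classical
  -- Reached elements are matched by `g`; an element of `Y` is matched by `e` unless it is near a
  -- partner so chosen.
  let T := Reached dα dβ r Y Y' e g
  let hit : α → Prop := fun a => ∃ b, T b ∧ dα.near r (g b) a
  let P₁ := (Y'.filter T).image fun b => (g b, b)
  let P₂ := (Y.filter fun a => ¬ hit a).image fun a => (a, e a)
  have hP₁ : ∀ {b}, T b → (g b, b) ∈ P₁ ∪ P₂ := fun {b} hb =>
    Finset.mem_union_left _ (Finset.mem_image.2 ⟨b, Finset.mem_filter.2 ⟨hb.mem, hb⟩, rfl⟩)
  have hP₂ : ∀ {a}, a ∈ Y → ¬ hit a → (a, e a) ∈ P₁ ∪ P₂ := fun {a} ha h =>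
    Finset.mem_union_right _ (Finset.mem_image.2 ⟨a, Finset.mem_filter.2 ⟨ha, h⟩, rfl⟩)
  have hP : ∀ p ∈ P₁ ∪ P₂, (T p.2 ∧ p.1 = g p.2) ∨ (p.1 ∈ Y ∧ ¬ hit p.1 ∧ p.2 = e p.1) := by
    intro p hp
    rcases Finset.mem_union.1 hp with hp | hp <;> obtain ⟨a, ha, rfl⟩ := Finset.mem_image.1 hp
    · exact .inl ⟨(Finset.mem_filter.1 ha).2, rfl⟩
    · exact .inr ⟨(Finset.mem_filter.1 ha).1, (Finset.mem_filter.1 ha).2, rfl⟩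
  -- If `e a` is near a reached `b`, then `b` was reached through some `a₁` with `e a₁` near `b`.
  -- Separation gives `a = a₁`, which is hit.
  have hfar : ∀ a ∈ Y, ¬ hit a → ∀ b, T b → ¬ dα.near c (g b) a ∧ ¬ dβ.near c (e a) b := by
    refine fun a ha hna b hb => ⟨fun h => hna ⟨b, hb, hg.near_or_far b hb.mem a ha h⟩, fun h => ?_⟩
    have h' := he.near_or_far a ha b hb.mem h
    cases hb with
    | base hb hb' => exact hb' a ha h'
    | @step b₁ _ a₁ hb₁ ha₁ _ h₁ h₂ =>
      have : a = a₁ := he.sep a ha a₁ ha₁ (near_of_near_near h' h₂ (by omega))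
      exact hna ⟨b₁, hb₁, this ▸ h₁⟩
  refine ⟨P₁ ∪ P₂, ?_, ?_, ?_, ?_, ?_⟩
  · refine (Finset.card_union_le _ _).trans ?_
    have h₁ : P₁.card ≤ Y'.card := Finset.card_image_le.trans (Finset.card_filter_le _ _)
    have h₂ : P₂.card ≤ Y.card := Finset.card_image_le.trans (Finset.card_filter_le _ _)
    omega
  · intro p hp
    rcases hP p hp with ⟨hT, h⟩ | ⟨hY, -, h⟩
    · exact h ▸ hg.rel _ hT.mem
    · exact h ▸ he.rel _ hY
  · rintro ⟨a, b⟩ hp ⟨a', b'⟩ hq hpq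
    rcases hP _ hp with ⟨hT, h⟩ | ⟨ha, hna, h⟩ <;>
      rcases hP _ hq with ⟨hT', h'⟩ | ⟨ha', hna', h'⟩ <;> dsimp only at * <;> subst h <;> subst h'
    · have : b = b' := hpq.elim (hg.sep _ hT.mem _ hT'.mem) (hY' _ hT.mem _ hT'.mem)
      rw [this]
    · have := hfar _ ha' hna' _ hT
      exact (hpq.elim this.1 fun h => this.2 (dβ.symm h)).elim
    · have := hfar _ ha hna _ hT'
      exact (hpq.elim (fun h => this.1 (dα.symm h)) this.2).elim
    · have : a = a' := hpq.elim (hY _ ha _ ha') (he.sep _ ha _ ha')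
      rw [this]
  · intro x hx
    by_cases h : hit x
    · obtain ⟨b, hb, hbx⟩ := h
      exact ⟨_, hP₁ hb, dα.symm hbx⟩
    · exact ⟨_, hP₂ hx h, dα.refl _ _⟩
  · intro y hy
    by_cases h : T y
    · exact ⟨_, hP₁ h, dβ.refl _ _⟩
    · have : ∃ a ∈ Y, dβ.near r (e a) y := by
        by_contra! h'
        exact h (.base hy h')
      obtain ⟨a, ha, hay⟩ := this
      refine ⟨_, hP₂ ha ?_, dβ.symm hay⟩
      rintro ⟨b, hb, hba⟩
      exact h (.step hb ha hy hba hay)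

/-! ### Pigeonhole arguments for radii and sizes -/

theorem exists_eq_succ_of_antitone {F : ℕ → ℕ} (hF : Antitone F) :
    ∃ j ≤ F 0, F j = F (j + 1) := by
  by_contra! h
  have : ∀ j ≤ F 0 + 1, F j + j ≤ F 0 := by
    intro j
    induction j with
    | zero => simp
    | succ j ih =>
      intro hj
      have h₁ := ih (by omega)
      have h₂ : F (j + 1) ≤ F j := hF (Nat.le_succ j)
      have h₃ := h j (by omega)
      omega
  have := this _ le_rfl
  omega

/-- The sum of all capped separation numbers of the sets `withImage (R m) X' I`, `I ⊆ X`. -/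
noncomputable def potential {α β : Type*} (dβ : Nearness β) (R : ℕ → α → β → Prop) (K : ℕ)
    (X : Finset α) (X' : Finset β) (m : ℕ) : ℕ :=
  ∑ I ∈ X.powerset, min (sepCap K) (dβ.sepNum (moveRadius m) (withImage (R m) X' I))

theorem potential_le {α β : Type*} {dβ : Nearness β} {R : ℕ → α → β → Prop} {K : ℕ}
    {X : Finset α} (hX : X.card ≤ K) (X' : Finset β) (m : ℕ) :
    potential dβ R K X X' m ≤ 2 ^ K * sepCap K := by
  refine (Finset.sum_le_card_nsmul _ _ (sepCap K) fun _ _ => min_le_left _ _).trans ?_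
  rw [Finset.card_powerset, smul_eq_mul]
  exact Nat.mul_le_mul_right _ (Nat.pow_le_pow_right (by norm_num) hX)

section Potential

variable {α β : Type*} [Finite β] {dβ : Nearness β} {R : ℕ → α → β → Prop}

theorem sepNum_withImage_anti (hR : Antitone R) (X' : Finset β) (I : Finset α) :
    Antitone fun m => dβ.sepNum (moveRadius m) (withImage (R m) X' I) := fun _ _ h =>
  sepNum_anti (moveRadius_mono h) (withImage_mono (hR h))

theorem potential_antitone (hR : Antitone R) (K : ℕ) (X : Finset α) (X' : Finset β) :
    Antitone (potential dβ R K X X') := fun _ _ h =>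
  Finset.sum_le_sum fun I _ => min_le_min_left _ (sepNum_withImage_anti hR X' I h)

theorem eq_of_potential_eq (hR : Antitone R) {K : ℕ} {X : Finset α} {X' : Finset β} {m m' : ℕ}
    (hm : m ≤ m') (h : potential dβ R K X X' m' = potential dβ R K X X' m) {I : Finset α}
    (hI : I ⊆ X) :
    min (sepCap K) (dβ.sepNum (moveRadius m) (withImage (R m) X' I)) =
      min (sepCap K) (dβ.sepNum (moveRadius m') (withImage (R m') X' I)) :=
  (((Finset.sum_eq_sum_iff_of_le fun I _ => min_le_min_left _
    (sepNum_withImage_anti hR X' I hm)).1 h) I (Finset.mem_powerset.2 hI)).symm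

/-- The term `I = ∅` of the potential is the separation number of `X'` itself, which is below the
cap. -/
theorem exists_separated_cover (hR : Antitone R) {K : ℕ} {X : Finset α} {X' : Finset β}
    {m m' : ℕ} (hX' : X'.card ≤ K) (hm : m ≤ m')
    (h : potential dβ R K X X' m' = potential dβ R K X X' m) :
    ∃ Y ⊆ X', dβ.Separated (moveRadius m') Y ∧ ∀ x ∈ X', ∃ y ∈ Y, dβ.near (moveRadius m) x y := by
  have h₁ := eq_of_potential_eq hR hm h (Finset.empty_subset X)
  have h₂ : ∀ R : α → β → Prop, withImage R X' ∅ = ↑X' := fun R => by simp [withImage]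
  rw [h₂, h₂] at h₁
  obtain ⟨Y, hYX, hY, hcard⟩ := dβ.exists_card_eq_sepNum (moveRadius m') (X' : Set β)
  refine ⟨Y, Finset.coe_subset.1 hYX, hY, fun x hx => exists_near_of_sepNum_le hYX
    (hY.anti (moveRadius_mono hm)) ?_ (Finset.mem_coe.2 hx)⟩
  have h₃ := sepNum_coe_le (d := dβ) (moveRadius m) X'
  rw [sepCap] at h₁
  omega

end Potential

/-- An upper bound for the ranks needed in `exists_matching`. -/
def matchingRank (K n w : ℕ) : ℕ :=
  n + (2 * (2 ^ K * sepCap K) + 1) * (w + 3)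

/-- If separated sets on both sides have separated images under `R m` for all `m`, then elements
of `X` and `X'` can be covered by a separated matching. -/
theorem exists_matching {α β : Type*} [Finite α] [Finite β] [Nonempty α] [Nonempty β]
    (dα : Nearness α) (dβ : Nearness β) (R : ℕ → α → β → Prop) (hR : Antitone R) (K n w : ℕ)
    (himg : ∀ m ≤ matchingRank K n w, ∀ S : Finset α, dα.Separated (moveRadius m) S →
      S.card ≤ K → HasSepImage dβ (R m) m S)
    (himg' : ∀ m ≤ matchingRank K n w, ∀ S : Finset β, dβ.Separated (moveRadius m) S →
      S.card ≤ K → HasSepImage dα (fun y x => R m x y) m S)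
    (X : Finset α) (X' : Finset β) (hX : X.card ≤ K) (hX' : X'.card ≤ K) :
    ∃ m ≥ n, ∃ P : Finset (α × β), P.card ≤ X.card + X'.card ∧ (∀ p ∈ P, R (m + w) p.1 p.2) ∧
      (∀ p ∈ P, ∀ q ∈ P, dα.near (moveRadius (m + w)) p.1 q.1 ∨
        dβ.near (moveRadius (m + w)) p.2 q.2 → p = q) ∧
      (∀ x ∈ X, ∃ p ∈ P, dα.near (moveRadius m) x p.1) ∧
      ∀ y ∈ X', ∃ p ∈ P, dβ.near (moveRadius m) y p.2 := by
  have hR' : Antitone fun m y x => R m x y := fun _ _ h y x => hR h x y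
  -- The potentials of both directions are added so that one step is stationary for both.
  let F : ℕ → ℕ := fun j =>
    potential dβ R K X X' (n + j * (w + 3)) +
      potential dα (fun m y x => R m x y) K X' X (n + j * (w + 3))
  have hmono : ∀ {i j : ℕ}, i ≤ j → n + i * (w + 3) ≤ n + j * (w + 3) := fun h =>
    Nat.add_le_add_left (Nat.mul_le_mul_right _ h) _
  have hF : Antitone F := fun i j h => add_le_add
    (potential_antitone hR K X X' (hmono h)) (potential_antitone hR' K X' X (hmono h))
  obtain ⟨j, hj, hjF⟩ := exists_eq_succ_of_antitone hF
  have hF₀ : F 0 ≤ 2 * (2 ^ K * sepCap K) := by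
    rw [two_mul]
    exact add_le_add (potential_le hX X' _) (potential_le hX' X _)
  obtain ⟨m₀, hm₀⟩ : ∃ m₀, m₀ = n + j * (w + 3) := ⟨_, rfl⟩
  obtain ⟨m₁, hm₁⟩ : ∃ m₁, m₁ = n + (j + 1) * (w + 3) := ⟨_, rfl⟩
  -- Let `ρ = moveRadius m₀`. The target separation is `c = moveRadius (m₀ + 1 + w) = 4 * 4 ^ w *
  -- ρ`, and `moveRadius m₁ = 16 * c` leaves room for `c + 2 * ρ` and `2 * c`.
  have hm₀₁ : m₁ = m₀ + w + 3 := by rw [hm₁, hm₀]; ring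
  have hle : m₁ ≤ matchingRank K n w := by
    rw [hm₁]
    exact hmono (by omega)
  have h01 : m₀ ≤ m₁ := by omega
  simp only [F, ← hm₀, ← hm₁] at hjF
  have hp₁ := potential_antitone (dβ := dβ) hR K X X' h01
  have hp₂ := potential_antitone (dβ := dα) hR' K X' X h01
  have hpot : potential dβ R K X X' m₁ = potential dβ R K X X' m₀ := by omega
  have hpot' : potential dα (fun m y x => R m x y) K X' X m₁ =
    potential dα (fun m y x => R m x y) K X' X m₀ := by omega
  have hr₁ : moveRadius m₁ = 64 * (4 ^ w * moveRadius m₀) := by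
    rw [hm₀₁]; simp only [moveRadius, pow_add]; ring
  have hr₂ : moveRadius (m₀ + 1 + w) = 4 * (4 ^ w * moveRadius m₀) := by
    simp only [moveRadius, pow_add]; ring
  have hr₃ : moveRadius (m₀ + 1) = 4 * moveRadius m₀ := by
    simp only [moveRadius, pow_add]; ring
  have hr₄ : moveRadius m₀ ≤ 4 ^ w * moveRadius m₀ := Nat.le_mul_of_pos_left _ (by positivity)
  obtain ⟨Y, hYX, hY, hYcov⟩ := exists_separated_cover hR' hX h01 hpot'
  obtain ⟨Y', hYX', hY', hYcov'⟩ := exists_separated_cover hR hX' h01 hpot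
  have hYc := Finset.card_le_card hYX
  have hYc' := Finset.card_le_card hYX'
  obtain ⟨e, he⟩ := exists_isSeparatedChoice dβ (R m₁) (R m₀) (hR h01) X' Y K (moveRadius m₀)
    (moveRadius (m₀ + 1 + w)) m₁ hX' (hYc.trans hX) (by omega) (by omega)
    (fun J hJ => himg m₁ hle J (hY.subset hJ) ((Finset.card_le_card hJ).trans (hYc.trans hX)))
    (fun J hJ => eq_of_potential_eq hR h01 hpot (hJ.trans hYX))
  obtain ⟨g, hg⟩ := exists_isSeparatedChoice dα (fun y x => R m₁ x y) (fun y x => R m₀ x y)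
    (hR' h01) X Y' K (moveRadius m₀)
    (moveRadius (m₀ + 1 + w)) m₁ hX (hYc'.trans hX') (by omega) (by omega)
    (fun J hJ => himg' m₁ hle J (hY'.subset hJ) ((Finset.card_le_card hJ).trans (hYc'.trans hX')))
    (fun J hJ => eq_of_potential_eq hR' h01 hpot' (hJ.trans hYX'))
  obtain ⟨P, hPcard, hPR, hPsep, hPY, hPY'⟩ := exists_matching_of_choices dα dβ (R m₁) Y Y'
    (2 * moveRadius m₀) (moveRadius (m₀ + 1 + w)) (by omega) (hY.anti (by omega))
    (hY'.anti (by omega)) e g ⟨he.rel, he.sep, fun x hx x' hx' => he.near_or_far x hx x' (hYX' hx')⟩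
    ⟨hg.rel, hg.sep, fun x hx x' hx' => hg.near_or_far x hx x' (hYX hx')⟩
  -- From `X` to the net `Y` the distance is at most `ρ`, from `Y` to `P` at most `2 * ρ`; the rank
  -- `m₀ + 1` allows `4 * ρ`.
  refine ⟨m₀ + 1, by omega, P, by omega, fun p hp => hR (by omega) _ _ (hPR p hp), hPsep, ?_, ?_⟩
  · intro x hx
    obtain ⟨y, hy, hxy⟩ := hYcov x hx
    obtain ⟨p, hp, hyp⟩ := hPY y hy
    exact ⟨p, hp, dα.mono (by omega) (dα.trans hxy hyp)⟩
  · intro x hx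
    obtain ⟨y, hy, hxy⟩ := hYcov' x hx
    obtain ⟨p, hp, hyp⟩ := hPY' y hy
    exact ⟨p, hp, dβ.mono (by omega) (dβ.trans hxy hyp)⟩

/-- Among finitely many values, one finds a gap of a prescribed form `[m, f m)`. -/
theorem exists_gap {f : ℕ → ℕ} (hf : Monotone f) (c : ℕ) (V : Finset ℕ) (hV : V.card ≤ c) :
    ∃ m ≤ f^[c] 0, ∀ v ∈ V, v < m ∨ f m ≤ v := by
  have hmono : Monotone fun j => f^[j] 0 := by
    refine monotone_nat_of_le_succ fun j => ?_
    rw [Function.iterate_succ_apply]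
    exact hf.iterate j (Nat.zero_le _)
  by_contra! h
  -- Otherwise each of the `c + 1` disjoint intervals from `f^[j] 0` to `f^[j + 1] 0` contains a
  -- value.
  have : ∀ j ≤ c + 1, j ≤ (V.filter (· < f^[j] 0)).card := by
    intro j
    induction j with
    | zero => simp
    | succ j ih =>
      intro hj
      obtain ⟨v, hvV, hv₁, hv₂⟩ := h (f^[j] 0) (hmono (by omega))
      refine Nat.succ_le_of_lt ((ih (by omega)).trans_lt (Finset.card_lt_card ?_))
      refine Finset.ssubset_iff_subset_ne.2 ⟨fun x hx => ?_, fun heq => ?_⟩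
      · have := Finset.mem_filter.1 hx
        exact Finset.mem_filter.2 ⟨this.1, this.2.trans_le (hmono (Nat.le_succ j))⟩
      · have : v ∈ V.filter (· < f^[j + 1] 0) :=
          Finset.mem_filter.2 ⟨hvV, by rwa [Function.iterate_succ_apply']⟩
        rw [← heq] at this
        exact absurd (Finset.mem_filter.1 this).2 (by omega)
  have h₁ := this (c + 1) le_rfl
  have h₂ := Finset.card_filter_le V (· < f^[c + 1] 0)
  omega

end SemiringLogic

/-! ### Boolean models with separate positive and negative literals -/

namespace SemiringLogic

open Nearness

/-- A Boolean model of the instantiated literals, in which the truth of a positive literal entails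
nearness of its elements, and in which negative literals hold for distant elements. -/
structure LocalModel (L : FirstOrder.Language.{u, v}) (A : Type w) extends Nearness A where
  lit : Literal L A → Prop
  near_of_pos : ∀ {k : ℕ} (R : L.Relations k) (t : Fin k → A), lit (.pos R t) →
    ∀ i j, near 1 (t i) (t j)
  neg_of_far : ∀ {k : ℕ} (R : L.Relations k) (t : Fin k → A) (i j : Fin k),
    ¬ near 1 (t i) (t j) → lit (.neg R t)

variable {L : FirstOrder.Language.{u, v}} {A A' : Type w}

namespace Formula

/-- Truth in a `LocalModel`. -/
def Sat (M : LocalModel L A) : {n : ℕ} → Formula L n → (Fin n → A) → Prop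
  | _, .eq i j, a => a i = a j
  | _, .ne i j, a => a i ≠ a j
  | _, .rel R t, a => M.lit (.pos R fun i => a (t i))
  | _, .nrel R t, a => M.lit (.neg R fun i => a (t i))
  | _, .and φ ψ, a => φ.Sat M a ∧ ψ.Sat M a
  | _, .or φ ψ, a => φ.Sat M a ∨ ψ.Sat M a
  | _, .ex φ, a => ∃ b : A, φ.Sat M (Fin.snoc (α := fun _ => A) a b)
  | _, .all φ, a => ∀ b : A, φ.Sat M (Fin.snoc (α := fun _ => A) a b)
  | _, .exBall r y φ, a => ∃ b, M.near r (a y) b ∧ φ.Sat M (Fin.snoc (α := fun _ => A) a b)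
  | _, .allBall r y φ, a => ∀ b, M.near r (a y) b → φ.Sat M (Fin.snoc (α := fun _ => A) a b)

variable {M : LocalModel L A}

theorem sat_rename {n m : ℕ} (f : Fin n → Fin m) (φ : Formula L n) (a : Fin m → A) :
    (φ.rename f).Sat M a ↔ φ.Sat M (a ∘ f) := by
  have hlift : ∀ {n m : ℕ} (f : Fin n → Fin m) (a : Fin m → A) (b : A),
      (Fin.snoc (α := fun _ => A) a b : Fin (m + 1) → A) ∘ liftRenaming f =
        Fin.snoc (α := fun _ => A) (a ∘ f) b := by
    intro n m f a b
    funext i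
    refine Fin.lastCases ?_ (fun i => ?_) i <;> simp [liftRenaming]
  induction φ generalizing m with
  | eq | ne | rel | nrel => rfl
  | and φ ψ ih₁ ih₂ => exact and_congr (ih₁ f a) (ih₂ f a)
  | or φ ψ ih₁ ih₂ => exact or_congr (ih₁ f a) (ih₂ f a)
  | ex φ ih => exact exists_congr fun b => (ih _ _).trans (iff_of_eq (by rw [hlift]))
  | all φ ih => exact forall_congr' fun b => (ih _ _).trans (iff_of_eq (by rw [hlift]))
  | exBall r y φ ih =>
    exact exists_congr fun b => and_congr Iff.rfl
      ((ih _ _).trans (iff_of_eq (by rw [hlift])))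
  | allBall r y φ ih =>
    exact forall_congr' fun b => imp_congr Iff.rfl
      ((ih _ _).trans (iff_of_eq (by rw [hlift])))

theorem sat_at' {m : ℕ} (φ : Formula L 1) (i : Fin m) (a : Fin m → A) :
    (φ.at' i).Sat M a ↔ φ.Sat M fun _ => a i :=
  sat_rename _ φ a

theorem sat_foldr_and {n : ℕ} (l : List (Formula L n)) (θ : Formula L n) (a : Fin n → A) :
    (l.foldr .and θ).Sat M a ↔ (∀ φ ∈ l, φ.Sat M a) ∧ θ.Sat M a := by
  induction l with
  | nil => simp
  | cons φ l ih => simp [Sat, ih, and_assoc]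

theorem sat_foldr_or {n : ℕ} (l : List (Formula L n)) (θ : Formula L n) (a : Fin n → A) :
    (l.foldr .or θ).Sat M a ↔ (∃ φ ∈ l, φ.Sat M a) ∨ θ.Sat M a := by
  induction l with
  | nil => simp
  | cons φ l ih => simp [Sat, ih, or_assoc]

theorem sat_foldr_or_map {n : ℕ} {ι : Type*} (l : List ι) (f : ι → Formula L n) (θ : Formula L n)
    (a : Fin n → A) :
    ((l.map f).foldr .or θ).Sat M a ↔ (∃ i ∈ l, (f i).Sat M a) ∨ θ.Sat M a := by
  simp only [sat_foldr_or, List.mem_map, exists_exists_and_eq_and]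

theorem sat_exs {n : ℕ} (φ : Formula L n) (a₀ : Fin 0 → A) :
    (exs φ).Sat M a₀ ↔ ∃ a, φ.Sat M a := by
  induction n with
  | zero => exact ⟨fun h => ⟨a₀, h⟩, fun ⟨a, h⟩ => Subsingleton.elim a a₀ ▸ h⟩
  | succ n ih =>
    refine (ih _).trans ⟨fun ⟨a, b, h⟩ => ⟨_, h⟩, fun ⟨a, h⟩ => ⟨Fin.init a, a (Fin.last n), ?_⟩⟩
    rwa [Fin.snoc_init_self]

theorem sat_alls {n : ℕ} (φ : Formula L n) (a₀ : Fin 0 → A) :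
    (alls φ).Sat M a₀ ↔ ∀ a, φ.Sat M a := by
  induction n with
  | zero => exact ⟨fun h a => Subsingleton.elim a₀ a ▸ h, fun h => h a₀⟩
  | succ n ih =>
    refine (ih _).trans ⟨fun h a => ?_, fun h a b => h _⟩
    have := h (Fin.init a) (a (Fin.last n))
    rwa [Fin.snoc_init_self] at this

theorem sat_distGT {n : ℕ} (s : ℕ) (i j : Fin n) (a : Fin n → A) :
    (distGT s i j : Formula L n).Sat M a ↔ ¬ M.near s (a i) (a j) := by
  simp only [distGT, Sat, Fin.snoc_last, Fin.snoc_castSucc]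
  exact ⟨fun h h' => h _ h' rfl, fun h b hb hba => h (hba ▸ hb)⟩

theorem sat_distLE {n : ℕ} (s : ℕ) (i j : Fin n) (a : Fin n → A) :
    (distLE s i j : Formula L n).Sat M a ↔ M.near s (a i) (a j) := by
  simp only [distLE, Sat, Fin.snoc_last, Fin.snoc_castSucc]
  exact ⟨fun ⟨b, hb, h⟩ => h ▸ hb, fun h => ⟨_, h, rfl⟩⟩

theorem mem_indexPairs {m : ℕ} (p : Fin m × Fin m) : p ∈ indexPairs m ↔ p.1 < p.2 := by
  obtain ⟨i, j⟩ := p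
  simp [indexPairs]

theorem sat_conjAt {k : ℕ} (φ : Formula L 1) (a : Fin (k + 1) → A) :
    (conjAt k φ).Sat M a ↔ ∀ i, φ.Sat M fun _ => a i := by
  simp only [conjAt, sat_foldr_and, List.forall_mem_map, sat_at', List.mem_finRange,
    forall_const]
  exact (Fin.forall_fin_succ' (P := fun i => φ.Sat M fun _ => a i)).symm

theorem sat_disjAt {k : ℕ} (φ : Formula L 1) (a : Fin (k + 1) → A) :
    (disjAt k φ).Sat M a ↔ ∃ i, φ.Sat M fun _ => a i := by
  simp only [disjAt, sat_foldr_or_map, sat_at', List.mem_finRange,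
    true_and]
  exact (Fin.exists_fin_succ' (P := fun i => φ.Sat M fun _ => a i)).symm

theorem sat_exScattered {r k : ℕ} (φ : Formula L 1) (a₀ : Fin 0 → A) :
    (exScattered r (conjAt k φ)).Sat M a₀ ↔ ∃ a : Fin (k + 1) → A,
      (∀ i j, i < j → ¬ M.near (2 * r) (a i) (a j)) ∧ ∀ i, φ.Sat M fun _ => a i := by
  simp only [exScattered, sat_exs, sat_foldr_and, List.forall_mem_map, sat_distGT,
    mem_indexPairs, Prod.forall, sat_conjAt]

theorem sat_allScattered {r k : ℕ} (φ : Formula L 1) (a₀ : Fin 0 → A) :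
    (allScattered r (disjAt k φ)).Sat M a₀ ↔ ∀ a : Fin (k + 1) → A,
      (∀ i j, i < j → ¬ M.near (2 * r) (a i) (a j)) → ∃ i, φ.Sat M fun _ => a i := by
  simp only [allScattered, sat_alls, sat_foldr_or_map, sat_distLE,
    mem_indexPairs, Prod.exists, sat_disjAt]
  refine forall_congr' fun a => ⟨fun h h' => h.resolve_left ?_, fun h => ?_⟩
  · rintro ⟨i, j, hij, hn⟩
    exact h' i j hij hn
  · by_contra! h'
    exact absurd (h fun i j hij => h'.1 i j hij) (by simpa using h'.2)

/-! ### Finite families of local formulae -/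

/-- The conjunction of a finite set of formulae. -/
noncomputable def conj {n : ℕ} (S : Finset (Formula L (n + 1))) : Formula L (n + 1) :=
  S.toList.foldr .and (.eq (Fin.last n) (Fin.last n))

/-- The disjunction of a finite set of formulae. -/
noncomputable def disj {n : ℕ} (S : Finset (Formula L (n + 1))) : Formula L (n + 1) :=
  S.toList.foldr .or (.ne (Fin.last n) (Fin.last n))

theorem sat_conj {n : ℕ} (S : Finset (Formula L (n + 1))) (a : Fin (n + 1) → A) :
    (conj S).Sat M a ↔ ∀ φ ∈ S, φ.Sat M a := by
  simp [conj, sat_foldr_and, Sat]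

theorem sat_disj {n : ℕ} (S : Finset (Formula L (n + 1))) (a : Fin (n + 1) → A) :
    (disj S).Sat M a ↔ ∃ φ ∈ S, φ.Sat M a := by
  simp [disj, sat_foldr_or, Sat]

theorem isLocalAux_conj {r n : ℕ} {d : Fin (n + 1) → ℕ} {S : Finset (Formula L (n + 1))}
    (hS : ∀ φ ∈ S, φ.IsLocalAux r d) : (conj S).IsLocalAux r d := by
  have : ∀ l : List (Formula L (n + 1)), (∀ φ ∈ l, φ.IsLocalAux r d) →
      (l.foldr Formula.and (Formula.eq (Fin.last n) (Fin.last n))).IsLocalAux r d := by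
    intro l
    induction l with
    | nil => simp [IsLocalAux]
    | cons φ l ih =>
      intro h
      exact ⟨h φ (by simp), ih fun ψ hψ => h ψ (by simp [hψ])⟩
  exact this _ fun φ hφ => hS φ (by simpa using hφ)

theorem isLocalAux_disj {r n : ℕ} {d : Fin (n + 1) → ℕ} {S : Finset (Formula L (n + 1))}
    (hS : ∀ φ ∈ S, φ.IsLocalAux r d) : (disj S).IsLocalAux r d := by
  have : ∀ l : List (Formula L (n + 1)), (∀ φ ∈ l, φ.IsLocalAux r d) →
      (l.foldr Formula.or (Formula.ne (Fin.last n) (Fin.last n))).IsLocalAux r d := by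
    intro l
    induction l with
    | nil => simp [IsLocalAux]
    | cons φ l ih =>
      intro h
      exact ⟨h φ (by simp), ih fun ψ hψ => h ψ (by simp [hψ])⟩
  exact this _ fun φ hφ => hS φ (by simpa using hφ)

/-- The literals with `n` variables. -/
def literals (L : FirstOrder.Language.{u, v}) (n : ℕ) : Set (Formula L n) :=
  (Set.range fun p : Fin n × Fin n => .eq p.1 p.2) ∪
  (Set.range fun p : Fin n × Fin n => .ne p.1 p.2) ∪
  (Set.range fun p : Σ R : (Σ k : ℕ, L.Relations k), Fin R.1 → Fin n => .rel p.1.2 p.2) ∪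
  (Set.range fun p : Σ R : (Σ k : ℕ, L.Relations k), Fin R.1 → Fin n => .nrel p.1.2 p.2)

theorem finite_literals [Finite (Σ k : ℕ, L.Relations k)] (n : ℕ) : (literals L n).Finite :=
  (((Set.finite_range _).union (Set.finite_range _)).union (Set.finite_range _)).union
    (Set.finite_range _)

theorem isLocalAux_of_mem_literals {r n : ℕ} {d : Fin n → ℕ} {φ : Formula L n}
    (h : φ ∈ literals L n) : φ.IsLocalAux r d := by
  rcases h with ((⟨p, rfl⟩ | ⟨p, rfl⟩) | ⟨p, rfl⟩) | ⟨p, rfl⟩ <;> exact trivial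

variable [Finite (Σ k : ℕ, L.Relations k)]

variable (L) in
open Classical in
/-- Finitely many local formulae that suffice to describe local games of `q` rounds. -/
noncomputable def localFormulas : ℕ → (n : ℕ) → Finset (Formula L n)
  | 0, n => (finite_literals n).toFinset
  | q + 1, n => localFormulas q n ∪
      ((Finset.univ ×ˢ (localFormulas q (n + 1)).powerset).image
        fun p : Fin n × Finset (Formula L (n + 1)) => .exBall (moveRadius q) p.1 (conj p.2)) ∪
      ((Finset.univ ×ˢ (localFormulas q (n + 1)).powerset).image
        fun p : Fin n × Finset (Formula L (n + 1)) => .allBall (moveRadius q) p.1 (disj p.2))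

theorem localFormulas_subset_succ (q n : ℕ) :
    localFormulas L q n ⊆ localFormulas L (q + 1) n := by
  classical
  exact fun _ h => Finset.mem_union_left _ (Finset.mem_union_left _ h)

theorem exBall_mem_localFormulas {q n : ℕ} (i : Fin n) {S : Finset (Formula L (n + 1))}
    (hS : S ⊆ localFormulas L q (n + 1)) :
    .exBall (moveRadius q) i (conj S) ∈ localFormulas L (q + 1) n := by
  classical
  exact Finset.mem_union_left _ (Finset.mem_union_right _ (Finset.mem_image.2
    ⟨(i, S), by simpa using hS, rfl⟩))

theorem allBall_mem_localFormulas {q n : ℕ} (i : Fin n) {S : Finset (Formula L (n + 1))}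
    (hS : S ⊆ localFormulas L q (n + 1)) :
    .allBall (moveRadius q) i (disj S) ∈ localFormulas L (q + 1) n := by
  classical
  exact Finset.mem_union_right _ (Finset.mem_image.2 ⟨(i, S), by simpa using hS, rfl⟩)

/-- An outermost quantifier of radius `2 * 4 ^ q` around a formula of locality `4 ^ q` stays within
`4 ^ (q + 1)`. -/
theorem isLocalAux_of_mem_localFormulas {q n r : ℕ} {d : Fin n → ℕ} {φ : Formula L n}
    (h : φ ∈ localFormulas L q n) (hd : ∀ i, d i + 4 ^ q ≤ r) : φ.IsLocalAux r d := by
  classical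
  induction q generalizing n with
  | zero => exact isLocalAux_of_mem_literals ((finite_literals n).mem_toFinset.1 h)
  | succ q ih =>
    have hd' : ∀ i, d i + 4 * 4 ^ q ≤ r := fun i => by
      have := hd i
      rwa [pow_succ'] at this
    have hsnoc : ∀ (y : Fin n) (i : Fin (n + 1)),
        (Fin.snoc (α := fun _ => ℕ) d (d y + moveRadius q) : Fin (n + 1) → ℕ) i + 4 ^ q ≤ r := by
      intro y i
      have hy := hd' y
      refine Fin.lastCases ?_ (fun i => ?_) i
      · rw [Fin.snoc_last, moveRadius]
        omega
      · have := hd' i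
        rw [Fin.snoc_castSucc]
        omega
    have hr : ∀ y : Fin n, d y + moveRadius q ≤ r := fun y => by
      have := hd' y
      rw [moveRadius]
      omega
    rcases Finset.mem_union.1 h with h | h
    · rcases Finset.mem_union.1 h with h | h
      · exact ih h fun i => by have := hd' i; omega
      · obtain ⟨⟨y, S⟩, hS, rfl⟩ := Finset.mem_image.1 h
        simp only [Finset.mem_product, Finset.mem_univ, true_and, Finset.mem_powerset] at hS
        exact ⟨hr y, isLocalAux_conj fun φ hφ => ih (hS hφ) (hsnoc y)⟩
    · obtain ⟨⟨y, S⟩, hS, rfl⟩ := Finset.mem_image.1 h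
      simp only [Finset.mem_product, Finset.mem_univ, true_and, Finset.mem_powerset] at hS
      exact ⟨hr y, isLocalAux_disj fun φ hφ => ih (hS hφ) (hsnoc y)⟩

end Formula

open Formula

/-! ### Local and global back-and-forth relations -/

/-- The pairs of `p` define a partial injection which preserves the truth of literals. -/
structure IsPartialHom (M : LocalModel L A) (M' : LocalModel L A') (p : Set (A × A')) : Prop where
  eq_iff : ∀ x ∈ p, ∀ y ∈ p, x.1 = y.1 ↔ x.2 = y.2
  pos : ∀ (k : ℕ) (R : L.Relations k) (c : Fin k → A × A'), (∀ i, c i ∈ p) →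
    M.lit (.pos R fun i => (c i).1) → M'.lit (.pos R fun i => (c i).2)
  neg : ∀ (k : ℕ) (R : L.Relations k) (c : Fin k → A × A'), (∀ i, c i ∈ p) →
    M.lit (.neg R fun i => (c i).1) → M'.lit (.neg R fun i => (c i).2)

theorem IsPartialHom.subset {M : LocalModel L A} {M' : LocalModel L A'} {p p' : Set (A × A')}
    (h : IsPartialHom M M' p') (hp : p ⊆ p') : IsPartialHom M M' p :=
  ⟨fun x hx y hy => h.eq_iff x (hp hx) y (hp hy), fun k R c hc => h.pos k R c fun i => hp (hc i),
    fun k R c hc => h.neg k R c fun i => hp (hc i)⟩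

/-- The local back-and-forth relation: `q` moves remain, and each move stays in the vicinity of
a position that is already in play. -/
def BackForth (M : LocalModel L A) (M' : LocalModel L A') : ℕ → Set (A × A') → Prop
  | 0, p => IsPartialHom M M' p
  | q + 1, p => BackForth M M' q p ∧ ∀ x ∈ p,
      (∀ b, M.near (moveRadius q) x.1 b →
        ∃ b', M'.near (moveRadius q) x.2 b' ∧ BackForth M M' q (insert (b, b') p)) ∧
      ∀ b', M'.near (moveRadius q) x.2 b' →
        ∃ b, M.near (moveRadius q) x.1 b ∧ BackForth M M' q (insert (b, b') p)

/-- The global back-and-forth relation. -/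
def GlobalBackForth (M : LocalModel L A) (M' : LocalModel L A') : ℕ → Set (A × A') → Prop
  | 0, p => IsPartialHom M M' p
  | q + 1, p => IsPartialHom M M' p ∧
      (∀ b, ∃ b', GlobalBackForth M M' q (insert (b, b') p)) ∧
      ∀ b', ∃ b, GlobalBackForth M M' q (insert (b, b') p)

section BackForth

variable {M : LocalModel L A} {M' : LocalModel L A'}

theorem GlobalBackForth.isPartialHom {q : ℕ} {p : Set (A × A')} (h : GlobalBackForth M M' q p) :
    IsPartialHom M M' p := by
  cases q with
  | zero => exact h
  | succ q => exact h.1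

theorem BackForth.anti {q q' : ℕ} {p : Set (A × A')} (h : BackForth M M' q' p) (hq : q ≤ q') :
    BackForth M M' q p := by
  induction hq with
  | refl => exact h
  | step _ ih => exact ih h.1

theorem BackForth.subset {q : ℕ} {p p' : Set (A × A')} (h : BackForth M M' q p') (hp : p ⊆ p') :
    BackForth M M' q p := by
  induction q generalizing p p' with
  | zero => exact IsPartialHom.subset h hp
  | succ q ih =>
    refine ⟨ih h.1 hp, fun x hx => ⟨fun b hb => ?_, fun b' hb' => ?_⟩⟩
    · obtain ⟨b', hb', h'⟩ := (h.2 x (hp hx)).1 b hb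
      exact ⟨b', hb', ih h' (Set.insert_subset_insert hp)⟩
    · obtain ⟨b, hb, h'⟩ := (h.2 x (hp hx)).2 b' hb'
      exact ⟨b, hb, ih h' (Set.insert_subset_insert hp)⟩

theorem GlobalBackForth.subset {q : ℕ} {p p' : Set (A × A')} (h : GlobalBackForth M M' q p')
    (hp : p ⊆ p') : GlobalBackForth M M' q p := by
  induction q generalizing p p' with
  | zero => exact IsPartialHom.subset h hp
  | succ q ih =>
    refine ⟨h.1.subset hp, fun b => ?_, fun b' => ?_⟩
    · obtain ⟨b', h'⟩ := h.2.1 b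
      exact ⟨b', ih h' (Set.insert_subset_insert hp)⟩
    · obtain ⟨b, h'⟩ := h.2.2 b'
      exact ⟨b, ih h' (Set.insert_subset_insert hp)⟩

/-- A tuple meeting both parts has two distant entries. Its positive atom is then false in `M` and
its negative atom true in `M'`, so there is nothing to transfer. -/
theorem IsPartialHom.union {p p' : Set (A × A')} (h : IsPartialHom M M' p)
    (h' : IsPartialHom M M' p')
    (hfar : ∀ x ∈ p, ∀ y ∈ p', ¬ M.near 1 x.1 y.1 ∧ ¬ M'.near 1 x.2 y.2) :
    IsPartialHom M M' (p ∪ p') := by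
  have hne : ∀ x ∈ p, ∀ y ∈ p', x.1 ≠ y.1 ∧ x.2 ≠ y.2 := fun x hx y hy =>
    ⟨fun h => (hfar x hx y hy).1 (h ▸ M.refl 1 x.1),
      fun h => (hfar x hx y hy).2 (h ▸ M'.refl 1 x.2)⟩
  have hmix : ∀ {k : ℕ} (c : Fin k → A × A'), (∀ i, c i ∈ p ∪ p') → (∀ i, c i ∈ p) ∨
      (∀ i, c i ∈ p') ∨ ∃ i j, c i ∈ p ∧ c j ∈ p' := by
    intro k c hc
    by_contra! hcon
    obtain ⟨⟨j, hj⟩, ⟨i, hi⟩, hij⟩ := hcon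
    exact hij i j ((hc i).resolve_right hi) ((hc j).resolve_left hj)
  refine ⟨?_, fun k R c hc hR => ?_, fun k R c hc hR => ?_⟩
  · rintro x (hx | hx) y (hy | hy)
    · exact h.eq_iff x hx y hy
    · exact iff_of_false (hne x hx y hy).1 (hne x hx y hy).2
    · exact iff_of_false (hne y hy x hx).1.symm (hne y hy x hx).2.symm
    · exact h'.eq_iff x hx y hy
  · rcases hmix c hc with hp | hp | ⟨i, j, hi, hj⟩
    · exact h.pos k R c hp hR
    · exact h'.pos k R c hp hR
    · exact absurd (M.near_of_pos R _ hR i j) (hfar _ hi _ hj).1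
  · rcases hmix c hc with hp | hp | ⟨i, j, hi, hj⟩
    · exact h.neg k R c hp hR
    · exact h'.neg k R c hp hR
    · exact M'.neg_of_far R _ i j (hfar _ hi _ hj).2

/-- A move covers at most `2 * 4 ^ q`, so parts more than `4 ^ (q + 1)` apart remain more than `4 ^
q` apart, and each part can be played by itself. -/
theorem BackForth.union {q : ℕ} {p p' : Set (A × A')} (h : BackForth M M' q p)
    (h' : BackForth M M' q p')
    (hfar : ∀ x ∈ p, ∀ y ∈ p', ¬ M.near (4 ^ q) x.1 y.1 ∧ ¬ M'.near (4 ^ q) x.2 y.2) :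
    BackForth M M' q (p ∪ p') := by
  induction q generalizing p p' with
  | zero => exact IsPartialHom.union h h' (by simpa using hfar)
  | succ q ih =>
    have hle : moveRadius q + 4 ^ q ≤ 4 ^ (q + 1) := by rw [moveRadius, pow_succ']; omega
    have key : ∀ p p' : Set (A × A'), BackForth M M' (q + 1) p → BackForth M M' q p' →
        (∀ x ∈ p, ∀ y ∈ p', ¬ M.near (4 ^ (q + 1)) x.1 y.1 ∧ ¬ M'.near (4 ^ (q + 1)) x.2 y.2) →
        ∀ x ∈ p, ∀ b b', M.near (moveRadius q) x.1 b → M'.near (moveRadius q) x.2 b' →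
          BackForth M M' q (insert (b, b') p) → BackForth M M' q (insert (b, b') (p ∪ p')) := by
      intro p p' _ h' hfar x hx b b' hb hb' hbf
      rw [← Set.insert_union]
      refine ih hbf h' fun z hz y hy => ?_
      rcases Set.mem_insert_iff.1 hz with rfl | hz
      · exact ⟨fun hn => (hfar x hx y hy).1 (M.mono hle (M.trans hb hn)),
          fun hn => (hfar x hx y hy).2 (M'.mono hle (M'.trans hb' hn))⟩
      · exact ⟨fun hn => (hfar z hz y hy).1 (M.mono (by omega) hn),
          fun hn => (hfar z hz y hy).2 (M'.mono (by omega) hn)⟩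
    have hfar' : ∀ x ∈ p', ∀ y ∈ p,
        ¬ M.near (4 ^ (q + 1)) x.1 y.1 ∧ ¬ M'.near (4 ^ (q + 1)) x.2 y.2 := fun x hx y hy =>
      ⟨fun hn => (hfar y hy x hx).1 (M.symm hn), fun hn => (hfar y hy x hx).2 (M'.symm hn)⟩
    refine ⟨ih h.1 h'.1 fun x hx y hy => ⟨fun hn => (hfar x hx y hy).1 (M.mono (by omega) hn),
      fun hn => (hfar x hx y hy).2 (M'.mono (by omega) hn)⟩, ?_⟩
    rintro x (hx | hx)
    · refine ⟨fun b hb => ?_, fun b' hb' => ?_⟩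
      · obtain ⟨b', hb', hbf⟩ := (h.2 x hx).1 b hb
        exact ⟨b', hb', key p p' h h'.1 hfar x hx b b' hb hb' hbf⟩
      · obtain ⟨b, hb, hbf⟩ := (h.2 x hx).2 b' hb'
        exact ⟨b, hb, key p p' h h'.1 hfar x hx b b' hb hb' hbf⟩
    · rw [Set.union_comm p p']
      refine ⟨fun b hb => ?_, fun b' hb' => ?_⟩
      · obtain ⟨b', hb', hbf⟩ := (h'.2 x hx).1 b hb
        exact ⟨b', hb', key p' p h' h.1 hfar' x hx b b' hb hb' hbf⟩
      · obtain ⟨b, hb, hbf⟩ := (h'.2 x hx).2 b' hb'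
        exact ⟨b, hb, key p' p h' h.1 hfar' x hx b b' hb hb' hbf⟩

/-- No local move is possible; the hypothesis only concerns nullary atoms. -/
theorem backForth_empty {q : ℕ} (h : IsPartialHom M M' ∅) : BackForth M M' q ∅ := by
  induction q with
  | zero => exact h
  | succ q ih => exact ⟨ih, fun x hx => hx.elim⟩

theorem backForth_of_separated {q : ℕ} (P : Finset (A × A')) (h₀ : IsPartialHom M M' ∅)
    (h : ∀ x ∈ P, BackForth M M' q {x})
    (hsep : ∀ x ∈ P, ∀ y ∈ P, M.near (4 ^ q) x.1 y.1 ∨ M'.near (4 ^ q) x.2 y.2 → x = y) :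
    BackForth M M' q ↑P := by
  classical
  induction P using Finset.induction_on with
  | empty => simpa using backForth_empty h₀
  | insert a P ha ih =>
    rw [Finset.coe_insert, Set.insert_eq]
    refine (h a (Finset.mem_insert_self a P)).union
      (ih (fun x hx => h x (Finset.mem_insert_of_mem hx)) fun x hx y hy =>
        hsep x (Finset.mem_insert_of_mem hx) y (Finset.mem_insert_of_mem hy)) ?_
    intro x hx y hy
    rw [Set.mem_singleton_iff.1 hx]
    have : ¬ (M.near (4 ^ q) a.1 y.1 ∨ M'.near (4 ^ q) a.2 y.2) := fun hn =>
      ha (hsep a (Finset.mem_insert_self a P) y (Finset.mem_insert_of_mem hy) hn ▸ hy)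
    exact not_or.1 this

/-- Each element of `X` is played as one local move, which is what the extra rank `X.card` pays for.
-/
theorem BackForth.exists_insert_left {m : ℕ} (X : Finset A) {p : Set (A × A')}
    (h : BackForth M M' (m + X.card) p) (hX : ∀ x ∈ X, ∃ y ∈ p, M.near (moveRadius m) x y.1) :
    ∃ p', p ⊆ p' ∧ BackForth M M' m p' ∧ p'.ncard ≤ p.ncard + X.card ∧
      ∀ x ∈ X, ∃ y ∈ p', y.1 = x := by
  classical
  induction X using Finset.induction_on generalizing p with
  | empty => exact ⟨p, subset_rfl, h, le_rfl, by simp⟩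
  | insert a X ha ih =>
    rw [Finset.card_insert_of_notMem ha, ← add_assoc] at h
    obtain ⟨y, hy, hay⟩ := hX a (Finset.mem_insert_self a X)
    obtain ⟨b', -, hbf⟩ := (h.2 y hy).1 a
      (M.mono (moveRadius_mono (Nat.le_add_right _ _)) (M.symm hay))
    obtain ⟨p', hp', hbf', hcard, hXp⟩ := ih hbf fun x hx => by
      obtain ⟨y, hy, hxy⟩ := hX x (Finset.mem_insert_of_mem hx)
      exact ⟨y, Set.mem_insert_of_mem _ hy, hxy⟩
    refine ⟨p', (Set.subset_insert _ _).trans hp', hbf', ?_, fun x hx => ?_⟩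
    · have := Set.ncard_insert_le (a, b') p
      rw [Finset.card_insert_of_notMem ha]
      omega
    · rcases Finset.mem_insert.1 hx with rfl | hx
      · exact ⟨_, hp' (Set.mem_insert _ _), rfl⟩
      · exact hXp x hx

theorem BackForth.exists_insert_right {m : ℕ} (X : Finset A') {p : Set (A × A')}
    (h : BackForth M M' (m + X.card) p) (hX : ∀ x ∈ X, ∃ y ∈ p, M'.near (moveRadius m) x y.2) :
    ∃ p', p ⊆ p' ∧ BackForth M M' m p' ∧ p'.ncard ≤ p.ncard + X.card ∧
      ∀ x ∈ X, ∃ y ∈ p', y.2 = x := by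
  classical
  induction X using Finset.induction_on generalizing p with
  | empty => exact ⟨p, subset_rfl, h, le_rfl, by simp⟩
  | insert a X ha ih =>
    rw [Finset.card_insert_of_notMem ha, ← add_assoc] at h
    obtain ⟨y, hy, hay⟩ := hX a (Finset.mem_insert_self a X)
    obtain ⟨b, -, hbf⟩ := (h.2 y hy).2 a
      (M'.mono (moveRadius_mono (Nat.le_add_right _ _)) (M'.symm hay))
    obtain ⟨p', hp', hbf', hcard, hXp⟩ := ih hbf fun x hx => by
      obtain ⟨y, hy, hxy⟩ := hX x (Finset.mem_insert_of_mem hx)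
      exact ⟨y, Set.mem_insert_of_mem _ hy, hxy⟩
    refine ⟨p', (Set.subset_insert _ _).trans hp', hbf', ?_, fun x hx => ?_⟩
    · have := Set.ncard_insert_le (b, a) p
      rw [Finset.card_insert_of_notMem ha]
      omega
    · rcases Finset.mem_insert.1 hx with rfl | hx
      · exact ⟨_, hp' (Set.mem_insert _ _), rfl⟩
      · exact hXp x hx

end BackForth

namespace Formula

/-- The quantifier rank of a first-order formula. -/
def quantifierRank : {n : ℕ} → Formula L n → ℕ
  | _, .eq _ _ => 0
  | _, .ne _ _ => 0
  | _, .rel _ _ => 0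
  | _, .nrel _ _ => 0
  | _, .and φ ψ => max φ.quantifierRank ψ.quantifierRank
  | _, .or φ ψ => max φ.quantifierRank ψ.quantifierRank
  | _, .ex φ => φ.quantifierRank + 1
  | _, .all φ => φ.quantifierRank + 1
  | _, .exBall _ _ φ => φ.quantifierRank + 1
  | _, .allBall _ _ φ => φ.quantifierRank + 1

theorem Sat.of_globalBackForth {M : LocalModel L A} {M' : LocalModel L A'} {n q : ℕ}
    {φ : Formula L n} (hφ : φ.IsFirstOrder) (hq : φ.quantifierRank ≤ q) {p : Set (A × A')}
    (hp : GlobalBackForth M M' q p) {a : Fin n → A} {a' : Fin n → A'}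
    (ha : ∀ i, (a i, a' i) ∈ p) (h : φ.Sat M a) : φ.Sat M' a' := by
  have hsnoc : ∀ {n : ℕ} {a : Fin n → A} {a' : Fin n → A'} {p : Set (A × A')} (b : A) (b' : A'),
      (∀ i, (a i, a' i) ∈ p) → ∀ i : Fin (n + 1),
        ((Fin.snoc (α := fun _ => A) a b : Fin (n + 1) → A) i,
          (Fin.snoc (α := fun _ => A') a' b' : Fin (n + 1) → A') i) ∈ insert (b, b') p := by
    intro n a a' p b b' ha i
    refine Fin.lastCases ?_ (fun i => ?_) i
    · simp
    · simpa using Or.inr (ha i)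
  induction φ generalizing q p with
  | eq i j => exact (hp.isPartialHom.eq_iff _ (ha i) _ (ha j)).1 h
  | ne i j => exact fun h' => h ((hp.isPartialHom.eq_iff _ (ha i) _ (ha j)).2 h')
  | rel R t => exact hp.isPartialHom.pos _ R (fun i => (a (t i), a' (t i))) (fun i => ha (t i)) h
  | nrel R t => exact hp.isPartialHom.neg _ R (fun i => (a (t i), a' (t i))) (fun i => ha (t i)) h
  | and φ ψ ih₁ ih₂ =>
    exact ⟨ih₁ hφ.1 ((le_max_left _ _).trans hq) hp ha h.1,
      ih₂ hφ.2 ((le_max_right _ _).trans hq) hp ha h.2⟩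
  | or φ ψ ih₁ ih₂ =>
    exact h.imp (ih₁ hφ.1 ((le_max_left _ _).trans hq) hp ha)
      (ih₂ hφ.2 ((le_max_right _ _).trans hq) hp ha)
  | ex φ ih =>
    obtain ⟨q, rfl⟩ := Nat.exists_eq_add_of_le' ((Nat.le_add_left 1 _).trans hq)
    obtain ⟨b, hb⟩ := h
    obtain ⟨b', hb'⟩ := hp.2.1 b
    exact ⟨b', ih hφ (Nat.le_of_succ_le_succ hq) hb' (hsnoc b b' ha) hb⟩
  | all φ ih =>
    obtain ⟨q, rfl⟩ := Nat.exists_eq_add_of_le' ((Nat.le_add_left 1 _).trans hq)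
    intro b'
    obtain ⟨b, hb⟩ := hp.2.2 b'
    exact ih hφ (Nat.le_of_succ_le_succ hq) hb (hsnoc b b' ha) (h b)
  | exBall => exact hφ.elim
  | allBall => exact hφ.elim

end Formula

/-! ### From preserved local types to local games -/

section Preserved

variable [Finite (Σ k : ℕ, L.Relations k)] {M : LocalModel L A} {M' : LocalModel L A'}

/-- All formulae of `localFormulas L q n` that hold for `a` also hold for `a'`. -/
def Preserved (M : LocalModel L A) (M' : LocalModel L A') (q : ℕ) {n : ℕ} (a : Fin n → A)
    (a' : Fin n → A') : Prop :=
  ∀ φ ∈ localFormulas L q n, φ.Sat M a → φ.Sat M' a'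

theorem isPartialHom_of_preserved {n : ℕ} {a : Fin n → A} {a' : Fin n → A'}
    (h : Preserved M M' 0 a a') : IsPartialHom M M' (Set.range fun i => (a i, a' i)) := by
  have hmem : ∀ φ ∈ literals L n, φ.Sat M a → φ.Sat M' a' := fun φ hφ =>
    h φ ((finite_literals n).mem_toFinset.2 hφ)
  refine ⟨?_, fun k R c hc => ?_, fun k R c hc => ?_⟩
  · rintro _ ⟨i, rfl⟩ _ ⟨j, rfl⟩
    refine ⟨hmem (.eq i j) (.inl (.inl (.inl ⟨(i, j), rfl⟩))), fun h' => ?_⟩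
    by_contra hne
    exact hmem (.ne i j) (.inl (.inl (.inr ⟨(i, j), rfl⟩))) hne h'
  · choose t ht using hc
    obtain rfl : (fun i => (a (t i), a' (t i))) = c := funext ht
    exact hmem (.rel R t) (.inl (.inr ⟨⟨⟨k, R⟩, t⟩, rfl⟩))
  · choose t ht using hc
    obtain rfl : (fun i => (a (t i), a' (t i))) = c := funext ht
    exact hmem (.nrel R t) (.inr ⟨⟨⟨k, R⟩, t⟩, rfl⟩)

theorem range_snoc_pair {n : ℕ} (a : Fin n → A) (a' : Fin n → A') (b : A) (b' : A') :
    (Set.range fun i : Fin (n + 1) => ((Fin.snoc (α := fun _ => A) a b : Fin (n + 1) → A) i,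
      (Fin.snoc (α := fun _ => A') a' b' : Fin (n + 1) → A') i)) =
      insert (b, b') (Set.range fun i => (a i, a' i)) := by
  ext z
  simp only [Set.mem_range, Set.mem_insert_iff, Fin.exists_fin_succ', Fin.snoc_castSucc,
    Fin.snoc_last]
  rw [or_comm, eq_comm (a := z)]

/-- A move `b` is answered using the conjunction of all formulae true at `b`, under a ball `∃`.
Since negation is missing, a move `b'` needs the dual: if no answer existed, the disjunction of all
formulae false at `b'` would hold throughout the ball in `M`, hence at `b'`. -/
theorem backForth_of_preserved {q n : ℕ} {a : Fin n → A} {a' : Fin n → A'}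
    (h : Preserved M M' q a a') : BackForth M M' q (Set.range fun i => (a i, a' i)) := by
  classical
  induction q generalizing n with
  | zero => exact isPartialHom_of_preserved h
  | succ q ih =>
    refine ⟨ih fun φ hφ => h φ (localFormulas_subset_succ q n hφ), ?_⟩
    rintro _ ⟨i, rfl⟩
    refine ⟨fun b hb => ?_, fun b' hb' => ?_⟩
    · obtain ⟨b', hb', hsat⟩ := h _ (exBall_mem_localFormulas i (Finset.filter_subset
        (fun φ : Formula L (n + 1) => φ.Sat M (Fin.snoc (α := fun _ => A) a b))
        (localFormulas L q (n + 1))))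
        ⟨b, hb, (sat_conj _ _).2 fun φ hφ => (Finset.mem_filter.1 hφ).2⟩
      refine ⟨b', hb', range_snoc_pair a a' b b' ▸ ih fun φ hφ hs => ?_⟩
      exact (sat_conj _ _).1 hsat φ (Finset.mem_filter.2 ⟨hφ, hs⟩)
    · by_contra hcon
      have hall := h _ (allBall_mem_localFormulas i (Finset.filter_subset
        (fun φ : Formula L (n + 1) => ¬ φ.Sat M' (Fin.snoc (α := fun _ => A') a' b'))
        (localFormulas L q (n + 1))))
        (fun b hb => (sat_disj _ _).2 (by
          by_contra! hno
          refine hcon ⟨b, hb, range_snoc_pair a a' b b' ▸ ih fun φ hφ hs => ?_⟩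
          by_contra hns
          exact hno φ (Finset.mem_filter.2 ⟨hφ, hns⟩) hs)) b' hb'
      obtain ⟨φ, hφ, hs⟩ := (sat_disj _ _).1 hall
      exact (Finset.mem_filter.1 hφ).2 hs

/-- `Preserved` for single elements. -/
def TypeLE (M : LocalModel L A) (M' : LocalModel L A') (q : ℕ) (x : A) (y : A') : Prop :=
  Preserved M M' q (fun _ : Fin 1 => x) fun _ : Fin 1 => y

theorem typeLE_antitone : Antitone (TypeLE M M') :=
  antitone_nat_of_succ_le fun q _ _ h φ hφ => h φ (localFormulas_subset_succ q 1 hφ)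

theorem TypeLE.backForth {q : ℕ} {x : A} {y : A'} (h : TypeLE M M' q x y) :
    BackForth M M' q {(x, y)} := by
  have := backForth_of_preserved h
  rwa [Set.range_const] at this

end Preserved

end SemiringLogic

namespace SemiringLogic

open Nearness Formula

variable {L : FirstOrder.Language.{u, v}} {A A' : Type w}

/-! ### Images of separated sets from scattered sentences -/

section Scattered

variable [Finite (Σ k : ℕ, L.Relations k)]

variable (L) in
open Classical in
/-- Finitely many basic local sentences, with localities `4 ^ m` for `m ≤ N` and with at most `k`
quantifiers. -/
noncomputable def scatteredSentences (N k : ℕ) : Finset (Formula L 0) :=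
  (Finset.range (N + 1)).biUnion fun m =>
    ((Finset.range k ×ˢ (localFormulas L m 1).powerset.powerset).image fun p =>
      exScattered (4 ^ m) (conjAt p.1 (disj (p.2.image conj)))) ∪
    ((Finset.range k ×ˢ (localFormulas L m 1).powerset.powerset).image fun p =>
      allScattered (4 ^ m) (disjAt p.1 (conj (p.2.image disj))))

theorem isLocalSentence_of_mem_scatteredSentences {N k : ℕ} {χ : Formula L 0}
    (h : χ ∈ scatteredSentences L N k) : χ.IsLocalSentence := by
  classical
  obtain ⟨m, -, h⟩ := Finset.mem_biUnion.1 h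
  have hloc : ∀ φ ∈ localFormulas L m 1, φ.IsLocalAux (4 ^ m) fun _ => 0 := fun φ hφ =>
    isLocalAux_of_mem_localFormulas hφ fun _ => by simp
  rcases Finset.mem_union.1 h with h | h <;> obtain ⟨⟨k, J⟩, hJ, rfl⟩ := Finset.mem_image.1 h <;>
    have hJ' := Finset.mem_powerset.1 (Finset.mem_product.1 hJ).2
  · refine .basicEx _ _ _ (isLocalAux_disj fun φ hφ => ?_)
    obtain ⟨S, hS, rfl⟩ := Finset.mem_image.1 hφ
    exact isLocalAux_conj fun φ hφ => hloc φ (Finset.mem_powerset.1 (hJ' hS) hφ)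
  · refine .basicAll _ _ _ (isLocalAux_conj fun φ hφ => ?_)
    obtain ⟨S, hS, rfl⟩ := Finset.mem_image.1 hφ
    exact isLocalAux_disj fun φ hφ => hloc φ (Finset.mem_powerset.1 (hJ' hS) hφ)

theorem exists_finset_of_scattered {B : Type*} {d : Nearness B} {c k : ℕ} {a : Fin k → B}
    (ha : ∀ i j, i < j → ¬ d.near c (a i) (a j)) :
    ∃ S : Finset B, d.Separated c S ∧ S.card = k ∧ ∀ e ∈ S, ∃ i, e = a i := by
  classical
  have hinj : ∀ i j, d.near c (a i) (a j) → i = j := by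
    intro i j hij
    rcases lt_trichotomy i j with h | h | h
    · exact absurd hij (ha i j h)
    · exact h
    · exact absurd (d.symm hij) (ha j i h)
  refine ⟨Finset.univ.image a, ?_, ?_, ?_⟩
  · intro x hx y hy hxy
    obtain ⟨i, -, rfl⟩ := Finset.mem_image.1 hx
    obtain ⟨j, -, rfl⟩ := Finset.mem_image.1 hy
    rw [hinj i j hxy]
  · rw [Finset.card_image_of_injective _ fun i j hij =>
      hinj i j (by rw [hij]; exact d.refl _ _), Finset.card_univ, Fintype.card_fin]
  · intro e he
    obtain ⟨i, -, rfl⟩ := Finset.mem_image.1 he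
    exact ⟨i, rfl⟩

theorem Nearness.Separated.exists_enum {B : Type*} {d : Nearness B} {c k : ℕ} {S : Finset B}
    (hS : d.Separated c S) (hk : S.card = k) :
    ∃ a : Fin k → B, (∀ i, a i ∈ S) ∧ ∀ i j, i < j → ¬ d.near c (a i) (a j) := by
  refine ⟨fun i => ((S.equivFinOfCardEq hk).symm i : B), fun i => Subtype.property _,
    fun i j hij h => ?_⟩
  have := hS _ (Subtype.property _) _ (Subtype.property _) h
  exact hij.ne ((S.equivFinOfCardEq hk).symm.injective (Subtype.ext this))

variable {M : LocalModel L A} {M' : LocalModel L A'} {N kmax : ℕ}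

/-- The sentence used asserts as many scattered elements as `S` has, each above the type of some
element of `S`. How often each type occurs is left open; Hall's condition needs no more. -/
theorem hasSepImage_of_scatteredSentences
    (hM : ∀ χ ∈ scatteredSentences L N kmax, χ.Sat M default → χ.Sat M' default)
    {m : ℕ} (hm : m ≤ N) {S : Finset A}
    (hS : M.Separated (moveRadius m) S) (hcard : S.card ≤ kmax) :
    HasSepImage M'.toNearness (TypeLE M M' m) m S := by
  classical
  obtain ⟨k, hk⟩ : ∃ k, S.card = k := ⟨_, rfl⟩
  cases k with
  | zero => exact ⟨∅, by simp [Separated], hk.symm, by simp⟩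
  | succ k =>
    let tp : A → Finset (Formula L 1) := fun x =>
      (localFormulas L m 1).filter fun φ => φ.Sat M fun _ => x
    have hmem : exScattered (4 ^ m) (conjAt k (disj ((S.image tp).image conj))) ∈
        scatteredSentences L N kmax := by
      refine Finset.mem_biUnion.2 ⟨m, Finset.mem_range.2 (by omega), Finset.mem_union_left _
        (Finset.mem_image.2 ⟨(k, S.image tp), Finset.mem_product.2
          ⟨Finset.mem_range.2 (by dsimp only; omega), Finset.mem_powerset.2 fun T hT => ?_⟩, rfl⟩)⟩
      obtain ⟨x, -, rfl⟩ := Finset.mem_image.1 hT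
      exact Finset.mem_powerset.2 (Finset.filter_subset _ _)
    obtain ⟨a, haS, ha⟩ := hS.exists_enum hk
    have hsat := hM _ hmem ((sat_exScattered _ _).2 ⟨a, ha, fun i => (sat_disj _ _).2
      ⟨_, Finset.mem_image_of_mem _ (Finset.mem_image_of_mem _ (haS i)),
        (sat_conj _ _).2 fun φ hφ => (Finset.mem_filter.1 hφ).2⟩⟩)
    obtain ⟨a', ha', hφ⟩ := (sat_exScattered _ _).1 hsat
    obtain ⟨S', hS', hcard', hSa⟩ := exists_finset_of_scattered ha'
    refine ⟨S', hS', hcard'.trans hk.symm, fun e he => ?_⟩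
    obtain ⟨i, rfl⟩ := hSa e he
    obtain ⟨_, hψ, hsat⟩ := (sat_disj _ _).1 (hφ i)
    obtain ⟨_, hT, rfl⟩ := Finset.mem_image.1 hψ
    obtain ⟨x, hx, rfl⟩ := Finset.mem_image.1 hT
    exact ⟨x, hx, fun φ hφ h => (sat_conj _ _).1 hsat φ (Finset.mem_filter.2 ⟨hφ, h⟩)⟩

/-- By contraposition: `S` refutes a universal sentence in `M'`, so the sentence fails in `M`. The
elements of a counterexample satisfy no formula that is false at a suitable `x ∈ S`, so their types
are below that of `x`. -/
theorem hasSepImage_symm_of_scatteredSentences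
    (hM : ∀ χ ∈ scatteredSentences L N kmax, χ.Sat M default → χ.Sat M' default)
    {m : ℕ} (hm : m ≤ N) {S : Finset A'}
    (hS : M'.Separated (moveRadius m) S) (hcard : S.card ≤ kmax) :
    HasSepImage M.toNearness (fun y x => TypeLE M M' m x y) m S := by
  classical
  obtain ⟨k, hk⟩ : ∃ k, S.card = k := ⟨_, rfl⟩
  cases k with
  | zero => exact ⟨∅, by simp [Separated], hk.symm, by simp⟩
  | succ k =>
    let tp : A' → Finset (Formula L 1) := fun x =>
      (localFormulas L m 1).filter fun φ => ¬ φ.Sat M' fun _ => x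
    have hmem : allScattered (4 ^ m) (disjAt k (conj ((S.image tp).image disj))) ∈
        scatteredSentences L N kmax := by
      refine Finset.mem_biUnion.2 ⟨m, Finset.mem_range.2 (by omega), Finset.mem_union_right _
        (Finset.mem_image.2 ⟨(k, S.image tp), Finset.mem_product.2
          ⟨Finset.mem_range.2 (by dsimp only; omega), Finset.mem_powerset.2 fun T hT => ?_⟩, rfl⟩)⟩
      obtain ⟨x, -, rfl⟩ := Finset.mem_image.1 hT
      exact Finset.mem_powerset.2 (Finset.filter_subset _ _)
    obtain ⟨a', haS, ha'⟩ := hS.exists_enum hk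
    have hsat : ¬ (allScattered (4 ^ m) (disjAt k (conj ((S.image tp).image disj)))).Sat M
        default := by
      intro h
      obtain ⟨i, hi⟩ := (sat_allScattered _ _).1 (hM _ hmem h) a' ha'
      obtain ⟨φ, hφ, hs⟩ := (sat_disj _ _).1 ((sat_conj _ _).1 hi _
        (Finset.mem_image_of_mem _ (Finset.mem_image_of_mem _ (haS i))))
      exact (Finset.mem_filter.1 hφ).2 hs
    rw [sat_allScattered] at hsat
    push Not at hsat
    obtain ⟨a, ha, hφ⟩ := hsat
    obtain ⟨S', hS', hcard', hSa⟩ := exists_finset_of_scattered ha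
    refine ⟨S', hS', hcard'.trans hk.symm, fun e he => ?_⟩
    obtain ⟨i, rfl⟩ := hSa e he
    have hi := hφ i
    rw [sat_conj] at hi
    push Not at hi
    obtain ⟨_, hψ, hsat⟩ := hi
    obtain ⟨_, hT, rfl⟩ := Finset.mem_image.1 hψ
    obtain ⟨x, hx, rfl⟩ := Finset.mem_image.1 hT
    refine ⟨x, hx, fun φ hφ h => ?_⟩
    by_contra hn
    exact hsat ((sat_disj _ _).2 ⟨φ, Finset.mem_filter.2 ⟨hφ, hn⟩, h⟩)

end Scattered

/-! ### Winning the global game -/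

section Game

variable [Finite (Σ k : ℕ, L.Relations k)] [Finite A] [Finite A']
  {M : LocalModel L A} {M' : LocalModel L A'}

/-- A local back-and-forth relation extends to a global one if elements that are far from the
current position have many possible answers. -/
theorem BackForth.globalBackForth {n b i : ℕ} {p : Set (A × A')} (hi : i ≤ n)
    (h : BackForth M M' i p) (hb : p.ncard + i ≤ b)
    (hA : ∀ i < n, ∀ a, (∃ x ∈ p, M.near (moveRadius i) x.1 a) ∨
      b ≤ M'.sepNum (moveRadius i) {e | TypeLE M M' i a e})
    (hA' : ∀ i < n, ∀ a', (∃ x ∈ p, M'.near (moveRadius i) x.2 a') ∨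
      b ≤ M.sepNum (moveRadius i) {e | TypeLE M M' i e a'}) :
    GlobalBackForth M M' i p := by
  classical
  induction i generalizing p with
  | zero => exact h
  | succ i ih =>
    have hle : 4 ^ i ≤ moveRadius i := by rw [moveRadius]; omega
    have hstep : ∀ c c', BackForth M M' i (insert (c, c') p) →
        GlobalBackForth M M' i (insert (c, c') p) := fun c c' hbf => by
      have := Set.ncard_insert_le (c, c') p
      exact ih (by omega) hbf (by omega)
        (fun j hj a => (hA j hj a).imp_left fun ⟨x, hx, hxa⟩ =>
          ⟨x, Set.mem_insert_of_mem _ hx, hxa⟩)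
        (fun j hj a => (hA' j hj a).imp_left fun ⟨x, hx, hxa⟩ =>
          ⟨x, Set.mem_insert_of_mem _ hx, hxa⟩)
    have hfar : ∀ c c', TypeLE M M' i c c' →
        (∀ x ∈ p, ¬ M.near (4 ^ i) c x.1 ∧ ¬ M'.near (4 ^ i) c' x.2) →
        BackForth M M' i (insert (c, c') p) := fun c c' hcc hx => by
      rw [Set.insert_eq]
      refine hcc.backForth.union h.1 fun z hz y hy => ?_
      rw [Set.mem_singleton_iff.1 hz]
      exact hx y hy
    refine ⟨(h.anti (Nat.zero_le _) : BackForth M M' 0 p), fun c => ?_, fun c' => ?_⟩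
    · by_cases hn : ∃ x ∈ p, M.near (moveRadius i) x.1 c
      · obtain ⟨x, hx, hxc⟩ := hn
        obtain ⟨c', -, hbf⟩ := (h.2 x hx).1 c hxc
        exact ⟨c', hstep c c' hbf⟩
      -- There are more realizations than pairs in `p`, separated by `2 * 4 ^ i`, so one is not `4 ^
      -- i`-near any element in play.
      · obtain ⟨S, hSU, hS, hcard⟩ := exists_card_eq ((hA i hi c).resolve_left hn)
        have hp : (Prod.snd '' p).toFinite.toFinset.card < S.card := by
          rw [← Set.ncard_eq_toFinset_card]
          have := Set.ncard_image_le (f := Prod.snd) p.toFinite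
          omega
        obtain ⟨c', hc', hfar'⟩ := hS.exists_far hp
        refine ⟨c', hstep c c' (hfar c c' (hSU hc') fun x hx => ⟨fun hcx => ?_, hfar' _ ?_⟩)⟩
        · exact hn ⟨x, hx, M.mono hle (M.symm hcx)⟩
        · simpa using ⟨x.1, hx⟩
    · by_cases hn : ∃ x ∈ p, M'.near (moveRadius i) x.2 c'
      · obtain ⟨x, hx, hxc⟩ := hn
        obtain ⟨c, -, hbf⟩ := (h.2 x hx).2 c' hxc
        exact ⟨c, hstep c c' hbf⟩
      · obtain ⟨S, hSU, hS, hcard⟩ := exists_card_eq ((hA' i hi c').resolve_left hn)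
        have hp : (Prod.fst '' p).toFinite.toFinset.card < S.card := by
          rw [← Set.ncard_eq_toFinset_card]
          have := Set.ncard_image_le (f := Prod.fst) p.toFinite
          omega
        obtain ⟨c, hc, hfar'⟩ := hS.exists_far hp
        refine ⟨c, hstep c c' (hfar c c' (hSU hc) fun x hx => ⟨hfar' _ ?_, fun hcx => ?_⟩)⟩
        · simpa using ⟨x.2, hx⟩
        · exact hn ⟨x, hx, M'.mono hle (M'.symm hcx)⟩

/-- The sets with small separation numbers can be covered by few elements. -/
theorem exists_cover_of_sepNum_lt {ι : Type*} (d : Nearness A) (I : Finset ι) (c : ι → ℕ)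
    (U : ι → Set A) (m : ℕ) :
    ∃ X : Finset A, X.card ≤ I.card * m ∧
      ∀ i ∈ I, d.sepNum (c i) (U i) < m → ∀ x ∈ U i, ∃ y ∈ X, d.near (c i) x y := by
  classical
  choose Z hZU hZ hcard using fun i => d.exists_card_eq_sepNum (c i) (U i)
  refine ⟨(I.filter fun i => d.sepNum (c i) (U i) < m).biUnion Z, ?_, fun i hi him x hx => ?_⟩
  · refine (Finset.card_biUnion_le_card_mul _ _ m fun i hi => ?_).trans
      (Nat.mul_le_mul_right _ (Finset.card_filter_le _ _))
    rw [hcard]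
    exact (Finset.mem_filter.1 hi).2.le
  · obtain ⟨y, hy, hxy⟩ := exists_near_of_sepNum_le (hZU i) (hZ i) (hcard i).ge hx
    exact ⟨y, Finset.mem_biUnion.2 ⟨i, Finset.mem_filter.2 ⟨hi, him⟩, hy⟩, hxy⟩

variable (L) in
/-- Indices for the local types of ranks less than `n`. -/
noncomputable def typeIndices (n : ℕ) : Finset (Σ _ : ℕ, Finset (Formula L 1)) :=
  (Finset.range n).sigma fun i => (localFormulas L i 1).powerset

variable (L) in
theorem exists_scatteredSentences_imp_globalBackForth (n : ℕ) :
    ∃ N k : ℕ, ∀ (A A' : Type w) [Finite A] [Finite A'] [Nonempty A] [Nonempty A']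
      (M : LocalModel L A) (M' : LocalModel L A'),
      (∀ χ ∈ scatteredSentences L N k, χ.Sat M default → χ.Sat M' default) →
        GlobalBackForth M M' n ∅ := by
  classical
  obtain ⟨T, hT⟩ : ∃ T, T = (typeIndices L n).card := ⟨_, rfl⟩
  -- With rarity threshold `m`, each of `X`, `X'` has at most `T * m` elements. The matching has at
  -- most `2 * (T * m)` pairs, adding `X` and `X'` themselves doubles this bound, and `n` rounds
  -- follow.
  obtain ⟨f, hf⟩ : ∃ f : ℕ → ℕ, f = fun m => 4 * (T * m) + n + 1 := ⟨_, rfl⟩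
  have hfmono : Monotone f := fun a b h => by
    have := Nat.mul_le_mul_left T h
    simp only [hf]
    omega
  -- There are `T` separation numbers on each side, so `mm` bounds the rarity threshold uniformly in
  -- the models, as the choice of `N` and `k` requires.
  obtain ⟨mm, hmm⟩ : ∃ mm, mm = f^[T + T] 0 := ⟨_, rfl⟩
  obtain ⟨K, hK⟩ : ∃ K, K = T * mm := ⟨_, rfl⟩
  refine ⟨max (matchingRank K n (2 * K)) n, max K (f mm), ?_⟩
  intro A A' _ _ _ _ M M' hM
  have himg : ∀ m, m ≤ max (matchingRank K n (2 * K)) n → ∀ S : Finset A,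
      M.Separated (moveRadius m) S → S.card ≤ max K (f mm) →
      HasSepImage M'.toNearness (TypeLE M M' m) m S := fun m hm S hS =>
    hasSepImage_of_scatteredSentences hM hm hS
  have himg' : ∀ m, m ≤ max (matchingRank K n (2 * K)) n → ∀ S : Finset A',
      M'.Separated (moveRadius m) S → S.card ≤ max K (f mm) →
      HasSepImage M.toNearness (fun y x => TypeLE M M' m x y) m S := fun m hm S hS =>
    hasSepImage_symm_of_scatteredSentences hM hm hS
  let up : (Σ _ : ℕ, Finset (Formula L 1)) → Set A := fun t => {e | ∀ φ ∈ t.2, φ.Sat M fun _ => e}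
  let down : (Σ _ : ℕ, Finset (Formula L 1)) → Set A' := fun t =>
    {e | ∀ φ ∈ t.2, ¬ φ.Sat M' fun _ => e}
  obtain ⟨m, hm, hgap⟩ := exists_gap hfmono (T + T)
    ((typeIndices L n).image (fun t => M.sepNum (moveRadius t.1) (up t)) ∪
      (typeIndices L n).image fun t => M'.sepNum (moveRadius t.1) (down t))
    ((Finset.card_union_le _ _).trans
      (hT ▸ Nat.add_le_add Finset.card_image_le Finset.card_image_le))
  have hfm : f m ≤ max K (f mm) := (hfmono (hmm ▸ hm)).trans (le_max_right _ _)
  obtain ⟨X, hXcard, hX⟩ := exists_cover_of_sepNum_lt M.toNearness (typeIndices L n)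
    (fun t => moveRadius t.1) up m
  obtain ⟨X', hXcard', hX'⟩ := exists_cover_of_sepNum_lt M'.toNearness (typeIndices L n)
    (fun t => moveRadius t.1) down m
  rw [← hT] at hXcard hXcard'
  have hTm : T * m ≤ K := hK ▸ Nat.mul_le_mul_left T (hmm ▸ hm)
  -- Elements of a rare type are near `X` by the choice of `X`. A frequent type has `f m` scattered
  -- realizations in `M`, and all elements of their image lie above `a`.
  have hrare : ∀ i < n, ∀ a, (∃ y ∈ X, M.near (moveRadius i) a y) ∨
      f m ≤ M'.sepNum (moveRadius i) {e | TypeLE M M' i a e} := by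
    intro i hi a
    let t : Σ _ : ℕ, Finset (Formula L 1) :=
      ⟨i, (localFormulas L i 1).filter fun φ => φ.Sat M fun _ => a⟩
    have ht : t ∈ typeIndices L n := Finset.mem_sigma.2
      ⟨Finset.mem_range.2 hi, Finset.mem_powerset.2 (Finset.filter_subset _ _)⟩
    rcases hgap _ (Finset.mem_union_left _ (Finset.mem_image_of_mem _ ht)) with h | h
    · exact .inl (hX t ht h a fun φ hφ => (Finset.mem_filter.1 hφ).2)
    · obtain ⟨S, hSU, hS, hcard⟩ := exists_card_eq h
      obtain ⟨S', hS', hcard', hSR⟩ := himg i (by omega) S hS (hcard.trans_le hfm)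
      refine .inr ((hcard'.trans hcard) ▸ card_le_sepNum (fun e he => ?_) hS')
      obtain ⟨x, hx, hxe⟩ := hSR e he
      exact fun φ hφ hs => hxe φ hφ (hSU hx φ (Finset.mem_filter.2 ⟨hφ, hs⟩))
  have hrare' : ∀ i < n, ∀ a', (∃ y ∈ X', M'.near (moveRadius i) a' y) ∨
      f m ≤ M.sepNum (moveRadius i) {e | TypeLE M M' i e a'} := by
    intro i hi a'
    let t : Σ _ : ℕ, Finset (Formula L 1) :=
      ⟨i, (localFormulas L i 1).filter fun φ => ¬ φ.Sat M' fun _ => a'⟩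
    have ht : t ∈ typeIndices L n := Finset.mem_sigma.2
      ⟨Finset.mem_range.2 hi, Finset.mem_powerset.2 (Finset.filter_subset _ _)⟩
    rcases hgap _ (Finset.mem_union_right _ (Finset.mem_image_of_mem _ ht)) with h | h
    · exact .inl (hX' t ht h a' fun φ hφ => (Finset.mem_filter.1 hφ).2)
    · obtain ⟨S, hSU, hS, hcard⟩ := exists_card_eq h
      obtain ⟨S', hS', hcard', hSR⟩ := himg' i (by omega) S hS (hcard.trans_le hfm)
      refine .inr ((hcard'.trans hcard) ▸ card_le_sepNum (fun e he => ?_) hS')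
      obtain ⟨x, hx, hxe⟩ := hSR e he
      refine fun φ hφ hs => ?_
      by_contra hn
      exact hSU hx φ (Finset.mem_filter.2 ⟨hφ, hn⟩) (hxe φ hφ hs)
  -- Nullary atoms are part of every local type, so any pair related by `TypeLE` transfers them.
  have hempty : IsPartialHom M M' ∅ := by
    obtain ⟨a⟩ := ‹Nonempty A›
    obtain ⟨S', -, hcard, hR⟩ := himg 0 (Nat.zero_le _) {a}
      (fun x hx y hy _ => (Finset.mem_singleton.1 hx).trans (Finset.mem_singleton.1 hy).symm)
      (by rw [Finset.card_singleton, hf]; dsimp only; omega)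
    obtain ⟨e, he⟩ : S'.Nonempty := Finset.card_pos.1 (by rw [hcard]; simp)
    obtain ⟨x, -, hxe⟩ := hR e he
    exact IsPartialHom.subset hxe.backForth (Set.empty_subset _)
  obtain ⟨m', hm', P, hPcard, hPR, hPsep, hPX, hPX'⟩ := exists_matching M.toNearness M'.toNearness
    (TypeLE M M') typeLE_antitone K n (2 * K)
    (fun m hm S hS hcard =>
      himg m (hm.trans (le_max_left _ _)) S hS (hcard.trans (le_max_left _ _)))
    (fun m hm S hS hcard =>
      himg' m (hm.trans (le_max_left _ _)) S hS (hcard.trans (le_max_left _ _)))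
    X X' (hXcard.trans hTm) (hXcard'.trans hTm)
  have hle : 4 ^ (m' + 2 * K) ≤ moveRadius (m' + 2 * K) := by rw [moveRadius]; omega
  -- The surplus `2 * K` in rank provides one move for each element of `X` and of `X'`.
  have hbf : BackForth M M' (m' + X'.card + X.card) ↑P :=
    (backForth_of_separated (q := m' + 2 * K) P hempty (fun x hx => (hPR x hx).backForth)
      fun x hx y hy hxy => hPsep x hx y hy (hxy.imp (M.mono hle) (M'.mono hle))).anti (by omega)
  obtain ⟨p, hPp, hbf, hpcard, hpX⟩ := hbf.exists_insert_left X fun x hx => by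
    obtain ⟨y, hy, hxy⟩ := hPX x hx
    exact ⟨y, hy, M.mono (moveRadius_mono (Nat.le_add_right _ _)) hxy⟩
  obtain ⟨p', hpp, hbf, hpcard', hpX'⟩ := hbf.exists_insert_right X' fun x hx => by
    obtain ⟨y, hy, hxy⟩ := hPX' x hx
    exact ⟨y, hPp hy, hxy⟩
  rw [Set.ncard_coe_finset] at hpcard
  have hglobal := (hbf.anti hm').globalBackForth le_rfl (b := f m) (by rw [hf]; dsimp only; omega)
    (fun i hi a => (hrare i hi a).imp_left fun ⟨y, hy, hay⟩ => by
      obtain ⟨z, hz, rfl⟩ := hpX y hy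
      exact ⟨z, hpp hz, M.symm hay⟩)
    (fun i hi a => (hrare' i hi a).imp_left fun ⟨y, hy, hay⟩ => by
      obtain ⟨z, hz, rfl⟩ := hpX' y hy
      exact ⟨z, hz, M'.symm hay⟩)
  exact hglobal.subset (Set.empty_subset _)

end Game

/-! ### From semiring values to Boolean models -/

section Thresholds

variable {K : Type x} [CommSemiring K] [LinearOrder K] [IsMinMaxSemiring K]

theorem IsMinMaxSemiring.zero_le (a : K) : 0 ≤ a := by
  have := IsMinMaxSemiring.add_eq_max 0 a
  rw [zero_add] at this
  exact this ▸ le_max_left 0 a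

theorem IsMinMaxSemiring.le_one (a : K) : a ≤ 1 := by
  have := IsMinMaxSemiring.mul_eq_min a 1
  rw [mul_one] at this
  exact this ▸ min_le_right a 1

theorem IsMinMaxSemiring.le_sum_iff {ι : Type*} {c : K} (hc : ¬ c ≤ 0) (s : Finset ι) (f : ι → K) :
    c ≤ ∑ i ∈ s, f i ↔ ∃ i ∈ s, c ≤ f i := by
  classical
  induction s using Finset.induction_on with
  | empty => simpa using hc
  | insert a s ha ih => simp [Finset.sum_insert ha, IsMinMaxSemiring.add_eq_max, ih]

theorem IsMinMaxSemiring.le_prod_iff {ι : Type*} {c : K} (s : Finset ι) (f : ι → K) :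
    c ≤ ∏ i ∈ s, f i ↔ ∀ i ∈ s, c ≤ f i := by
  classical
  induction s using Finset.induction_on with
  | empty => simpa using IsMinMaxSemiring.le_one c
  | insert a s ha ih => simp [Finset.prod_insert ha, IsMinMaxSemiring.mul_eq_min, ih]

variable [L.IsRelational] [Fintype A]

/-- The Boolean model of the literals whose value under `π` is at least `c`. -/
noncomputable def thresholdModel (π : Interpretation L A K) (h₁ : ModelDefining π)
    (h₂ : TracksOnlyPositive π) {c : K} (hc : ¬ c ≤ 0) : LocalModel L A where
  near r a b := b ∈ ball π r a
  refl r a := by simp [ball]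
  symm h := by simpa [ball, SimpleGraph.edist_comm] using h
  mono hrs h := by
    simp only [ball, Finset.mem_filter, Finset.mem_univ, true_and] at h ⊢
    exact h.trans (by exact_mod_cast hrs)
  trans hr hs := by
    simp only [ball, Finset.mem_filter, Finset.mem_univ, true_and] at hr hs ⊢
    rw [Nat.cast_add]
    exact SimpleGraph.edist_triangle.trans (add_le_add hr hs)
  lit l := c ≤ π l
  near_of_pos := by
    intro k R t h i j
    simp only [ball, Finset.mem_filter, Finset.mem_univ, true_and]
    by_cases hij : t i = t j
    · simp [hij]
    · have hadj : (gaifmanGraph (inducedStructure π)).Adj (t i) (t j) :=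
        ⟨hij, k, R, t, fun h0 => hc (h0 ▸ h), ⟨i, rfl⟩, ⟨j, rfl⟩⟩
      rw [SimpleGraph.edist_eq_one_iff_adj.2 hadj]
      simp
  neg_of_far := by
    intro k R t i j h
    -- Both assumptions on `π` enter here: a vanishing positive literal makes the negative one
    -- nonzero, hence `1`, which is above every threshold.
    have h0 : π (.pos R t) = 0 := by
      by_contra h0
      apply h
      simp only [ball, Finset.mem_filter, Finset.mem_univ, true_and]
      by_cases hij : t i = t j
      · simp [hij]
      · have hadj : (gaifmanGraph (inducedStructure π)).Adj (t i) (t j) :=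
          ⟨hij, k, R, t, h0, ⟨i, rfl⟩, ⟨j, rfl⟩⟩
        rw [SimpleGraph.edist_eq_one_iff_adj.2 hadj]
        simp
    have h1 : π (.neg R t) ≠ 0 := by
      rcases h₁ k R t with h | h
      · exact h.2
      · exact absurd h0 h.2
    rw [(h₂ k R t).resolve_left h1]
    exact IsMinMaxSemiring.le_one c

/-- In a total order, a cut turns `max` into disjunction and `min` into conjunction; `hc` keeps `0`
on the false side. -/
theorem Formula.le_eval_iff {π : Interpretation L A K} {h₁ : ModelDefining π}
    {h₂ : TracksOnlyPositive π} {c : K} (hc : ¬ c ≤ 0) {n : ℕ} (φ : Formula L n) (a : Fin n → A) :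
    c ≤ φ.eval π a ↔ φ.Sat (thresholdModel π h₁ h₂ hc) a := by
  have hite : ∀ (P : Prop) (_ : Decidable P), c ≤ (if P then 1 else 0 : K) ↔ P := fun P _ => by
    split_ifs with h
    · exact iff_of_true (IsMinMaxSemiring.le_one c) h
    · exact iff_of_false hc h
  induction φ with
  | eq i j => exact hite _ _
  | ne i j => exact hite _ _
  | rel | nrel => exact Iff.rfl
  | and φ ψ ih₁ ih₂ => simp [eval, Sat, IsMinMaxSemiring.mul_eq_min, ih₁, ih₂]
  | or φ ψ ih₁ ih₂ => simp [eval, Sat, IsMinMaxSemiring.add_eq_max, ih₁, ih₂]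
  | ex φ ih => simp [eval, Sat, IsMinMaxSemiring.le_sum_iff hc, ih]
  | all φ ih => simp [eval, Sat, IsMinMaxSemiring.le_prod_iff, ih]
  | exBall r y φ ih =>
    simp only [eval, Sat, IsMinMaxSemiring.le_sum_iff hc, ih]
    rfl
  | allBall r y φ ih =>
    simp only [eval, Sat, IsMinMaxSemiring.le_prod_iff, ih]
    rfl

end Thresholds

/-- Formulae are minmax-equivalent if they hold in the same finite nonempty Boolean models. -/
theorem minMaxEquiv_of_sat_iff [L.IsRelational] {n : ℕ} {φ ψ : Formula L n}
    (h : ∀ (A : Type w) [Finite A] [Nonempty A] (M : LocalModel L A) (a : Fin n → A),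
      φ.Sat M a ↔ ψ.Sat M a) :
    MinMaxEquiv.{u, v, w, x} φ ψ := by
  intro K _ _ _ A _ _ π h₁ h₂ a
  refine eq_of_forall_le_iff fun c => ?_
  by_cases hc : c ≤ 0
  · exact iff_of_true (hc.trans (IsMinMaxSemiring.zero_le _))
      (hc.trans (IsMinMaxSemiring.zero_le _))
  · rw [le_eval_iff (h₁ := h₁) (h₂ := h₂) hc, le_eval_iff (h₁ := h₁) (h₂ := h₂) hc]
    exact h A _ a

/-! ### Definability from preservation -/

/-- A sentence whose truth is preserved along with the truth of finitely many local sentences is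
equivalent to a positive Boolean combination of these. -/
theorem exists_isLocalSentence_of_preserved {ψ : Formula L 0} (Λ : Finset (Formula L 0))
    (hΛ : ∀ χ ∈ Λ, χ.IsLocalSentence)
    (h : ∀ (A A' : Type w) [Finite A] [Finite A'] [Nonempty A] [Nonempty A']
      (M : LocalModel L A) (M' : LocalModel L A'),
      (∀ χ ∈ Λ, χ.Sat M default → χ.Sat M' default) → ψ.Sat M default → ψ.Sat M' default) :
    ∃ χ : Formula L 0, χ.IsLocalSentence ∧ ∀ (A : Type w) [Finite A] [Nonempty A]
      (M : LocalModel L A) (a : Fin 0 → A), ψ.Sat M a ↔ χ.Sat M a := by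
  classical
  -- Empty conjunctions and disjunctions must be local sentences too; with a single variable there
  -- is no distance condition.
  let ltop : Formula L 0 := exScattered 0 (conjAt 0 (.eq 0 0))
  let lbot : Formula L 0 := exScattered 0 (conjAt 0 (.ne 0 0))
  have htop : ∀ (A : Type w) [Nonempty A] (M : LocalModel L A), ltop.Sat M default :=
    fun A hA M => (sat_exScattered _ _).2 ⟨fun _ => hA.some, fun i j hij =>
      absurd (Subsingleton.elim (α := Fin 1) i j) hij.ne, fun _ => rfl⟩
  have hbot : ∀ (A : Type w) (M : LocalModel L A), ¬ lbot.Sat M default := fun A M hs => by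
    obtain ⟨a, -, ha⟩ := (sat_exScattered _ _).1 hs
    exact ha 0 rfl
  have hand : ∀ l : List (Formula L 0), (∀ χ ∈ l, χ.IsLocalSentence) →
      (l.foldr .and ltop).IsLocalSentence := by
    intro l
    induction l with
    | nil => exact fun _ => .basicEx 0 0 (.eq 0 0) trivial
    | cons φ l ih => exact fun hl => .and (hl φ (by simp)) (ih fun χ hχ => hl χ (by simp [hχ]))
  have hor : ∀ l : List (Formula L 0), (∀ χ ∈ l, χ.IsLocalSentence) →
      (l.foldr .or lbot).IsLocalSentence := by
    intro l
    induction l with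
    | nil => exact fun _ => .basicEx 0 0 (.ne 0 0) trivial
    | cons φ l ih => exact fun hl => .or (hl φ (by simp)) (ih fun χ hχ => hl χ (by simp [hχ]))
  -- Each good `S` contains all sentences of `Λ` true in some model of `ψ`, so a model of `S`
  -- satisfies `ψ` by preservation. As `Λ` is finite, finitely many `S` account for all models.
  let good : Finset (Finset (Formula L 0)) := Λ.powerset.filter fun S =>
    ∃ (A : Type w) (_ : Finite A) (_ : Nonempty A) (M : LocalModel L A), ψ.Sat M default ∧
      ∀ χ ∈ Λ, χ.Sat M default → χ ∈ S
  refine ⟨(good.toList.map fun S => S.toList.foldr .and ltop).foldr .or lbot, hor _ ?_, ?_⟩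
  · rw [List.forall_mem_map]
    intro S hS
    have hS' := Finset.mem_powerset.1 (Finset.mem_filter.1 (Finset.mem_toList.1 hS)).1
    exact hand _ fun χ hχ => hΛ χ (hS' (Finset.mem_toList.1 hχ))
  · intro A _ _ M a
    obtain rfl : a = default := Subsingleton.elim _ _
    simp only [sat_foldr_or_map, sat_foldr_and, Finset.mem_toList]
    constructor
    · intro hψ
      refine .inl ⟨Λ.filter fun χ => χ.Sat M default, ?_,
        fun χ hχ => (Finset.mem_filter.1 hχ).2, htop A M⟩
      exact Finset.mem_filter.2 ⟨Finset.mem_powerset.2 (Finset.filter_subset _ _), A, ‹_›, ‹_›, M,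
        hψ, fun χ hχ hs => Finset.mem_filter.2 ⟨hχ, hs⟩⟩
    · rintro (⟨S, hS, hsat, -⟩ | hb)
      · obtain ⟨B, _, _, M₀, hψ, hM₀⟩ := (Finset.mem_filter.1 hS).2
        exact h B A M₀ M (fun χ hχ hs => hsat χ (hM₀ χ hχ hs)) hψ
      · exact absurd hb (hbot A M)

end SemiringLogic

/-- Gaifman normal form for min-max semirings: over a finite relational signature, each
first-order sentence is minmax-equivalent to a local sentence. -/
theorem mainTheorem1 (L : FirstOrder.Language.{u, v}) [L.IsRelational]
    [Finite (Σ k : ℕ, L.Relations k)]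
    (ψ : SemiringLogic.Formula L 0) (hψ : ψ.IsFirstOrder) :
    ∃ χ : SemiringLogic.Formula L 0,
      χ.IsLocalSentence ∧ SemiringLogic.MinMaxEquiv.{u, v, w, x} ψ χ := by
  obtain ⟨N, k, h⟩ :=
    SemiringLogic.exists_scatteredSentences_imp_globalBackForth.{u, v, w} L ψ.quantifierRank
  obtain ⟨χ, hχ, hiff⟩ := SemiringLogic.exists_isLocalSentence_of_preserved.{u, v, w}
    (SemiringLogic.scatteredSentences L N k)
    (fun _ => SemiringLogic.isLocalSentence_of_mem_scatteredSentences)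
    (fun A A' _ _ _ _ M M' hM hs => SemiringLogic.Formula.Sat.of_globalBackForth hψ le_rfl
      (h A A' M M' hM) (fun i => i.elim0) hs)
  exact ⟨χ, hχ, SemiringLogic.minMaxEquiv_of_sat_iff hiff⟩
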